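/- **Setting.** Let $z=(z_1,\dots,z_N)\in\mathbb R^n$ with $z_k\in\mathbb R^{n_k}$, and consider $$\min_{z\in E\cap Z}\ \tfrac12 z^\top Hz+h^\top z,\qquad (\ast)$$ where $H\in\mathbb R^{n\times n}$ is symmetric positive definite, $Z=\prod_{k=1}^N\bigcup_{i=1}^{m_k}Z_{k,i}$ with each $Z_{k,i}=\{x\in\mathbb R^{n_k}: G_{k,i}x=g_{k,i},\ F_{k,i}x\le f_{k,i}\}$ a closed convex polyhedron, $E=\{z: Az=b\}=\{Vv+\bar v: v\in\mathbb R^{n-m}\}$ with $A\in\mathbb R^{m\times n}$ of full row rank and $V$ of full column rank, and $E\cap Z\ne\varnothing$. **Notation.** $P_Z(s)=\arg\min_{y\in Z}\|s-y\|$ is the set-valued Euclidean projection. For a set $C$ and $z\in C$, the regular normal cone is $\hat N_C(z)=\{x:\limsup_{u\to z,\,u\in C,\,u\neq z}\langle x,u-z\rangle/\|u-z\|\le 0\}$, and $\hat N_C(z)=\varnothing$ for $z\notin C$. A pair $(z,\lambda)$ is a *regular KKT point* if $0\in Hz+h+\hat N_E(z)-\lambda$ and $0\in\hat N_Z(z)+\lambda$;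 for $\xi>0$ it is a *$\xi$-proximal KKT point* if $0\in Hz+h+\hat N_E(z)-\lambda$ and $z\in P_Z(z-\tfrac1\xi\lambda)$. Put $R=V(V^\top HV)^{-1}V^\top$, $M_\xi=\xi(\xi R-I)^{-1}R$, $c_\xi=(\xi R-I)^{-1}(R(h+H\bar v)-\bar v)$. If $M_\xi=Q\,\mathrm{diag}(\Lambda,0)\,Q^\top$ is the eigendecomposition of $M_\xi$ ($Q$ orthogonal, $\Lambda$ the diagonal matrix of nonzero eigenvalues), let $W=Q\,\mathrm{diag}(\tfrac12\Lambda^{-1},-I)\,Q^\top$, and define the set-valued operator $T_\xi(s)=s-W\big(M_\xi s+c_\xi-P_Z(s)\big)$, with $\operatorname{Fix}T_\xi=\{s: s\in T_\xi(s)\}$. The fixed points *corresponding to* $z$ are $\operatorname{Fix}_z T_\xi=\{s:(z,\xi(z-s))\text{ is a }\xi\text{-proximal KKT point}\}$, a convex set. **Algorithm 1** (step size $\gamma\in(0,1)$, initial iterate $s_0$). If $z^\star:=\bar v-R(h+H\bar v)\in Z$, return $z^\star$. Otherwise iterate, for $j=0,1,\dots$: $z_{j+1}=M_\xi s_j+c_\xi$,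 $y_{j+1}\in P_Z(s_j)$, $s_{j+1}=s_j-\gamma W(z_{j+1}-y_{j+1})$. **Assumptions.** (A1) There is a regular KKT point. (A2) For every local minimum $z$ of $(\ast)$ and every $\bar\xi>0$ with $\operatorname{Fix}_zT_{\bar\xi}\neq\varnothing$ and $z\notin\operatorname{Fix}_zT_{\bar\xi}$, there are $\xi\ge\bar\xi$ and $s\in\operatorname{Fix}_zT_\xi$ such that $-\xi(z-s)$ lies in the relative interior of $\hat N_Z(z)$. (A3) For every $z\in Z$, either $\hat N_Z(z)=\{0\}$, or there is $\epsilon>0$ such that $z+w\in Z$ for all $w\in\hat N_Z(z)^\perp$ with $\|w\|\le\epsilon$. **Theorem (local convergence to local minima).** Under (A1)–(A3) there is $\xi_0>0$ such that for every $\xi\ge\xi_0$ the matrix $\xi R-I$ is invertible, $\operatorname{Fix}T_\xi\neq\varnothing$, $\operatorname{Fix}T_\xi$ is the union of the sets $\operatorname{Fix}_{z}T_\xi$ over the local minima $z$ of $(\ast)$, and the following hold. 1. If $z^\star\in Z$ (so that Algorithm 1 returns $z^\star$ at once), then $z^\star\in\operatorname{Fix}T_\xi$ and $z^\star$ is a global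 minimum of $(\ast)$. 2. For every local minimum $z^\circ\ne z^\star$ of $(\ast)$ and all $s^\circ\in\operatorname{Fix}_{z^\circ}T_\xi$, except for a subset of measure zero (with respect to the $d$-dimensional Hausdorff, i.e. Lebesgue, measure, $d$ being the dimension of the affine hull of $\operatorname{Fix}_{z^\circ}T_\xi$), there is $\epsilon>0$ such that for every $\gamma\in(0,1)$ and every $s_0$ with $\|s_0-s^\circ\|\le\epsilon$, every sequence $(s_j)$ generated by the iteration of Algorithm 1 converges to some point of $\operatorname{Fix}T_\xi$. 3. Whenever, for some $\gamma\in(0,1)$ and some $s_0$, a sequence $(s_j)$ generated by the iteration of Algorithm 1 converges, its limit belongs to $\operatorname{Fix}T_\xi$, $\|z_j-y_j\|\to0$, and $z_j$ and $y_j$ converge to a common limit that is a local minimum of $(\ast)$. -/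

import Mathlib

open scoped Matrix Topology MeasureTheory

noncomputable section

/-! ## Variational geometry in a Euclidean space -/

/-- The (set-valued) Euclidean projection: all points of `C` at minimal distance from `s`. -/
def euclProj {ι : Type} [Fintype ι] (C : Set (EuclideanSpace ℝ ι)) (s : EuclideanSpace ℝ ι) :
    Set (EuclideanSpace ℝ ι) :=
  {y | y ∈ C ∧ ∀ u ∈ C, ‖s - y‖ ≤ ‖s - u‖}

/-- The regular (Fréchet) normal cone of `C` at `z`: all `x` such that the upper limit of
`⟪x, u - z⟫ / ‖u - z‖`, as `u → z` with `u ∈ C` and `u ≠ z`, is at most `0`.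
It is empty when `z ∉ C`. -/
def regNormalCone {ι : Type} [Fintype ι] (C : Set (EuclideanSpace ℝ ι))
    (z : EuclideanSpace ℝ ι) : Set (EuclideanSpace ℝ ι) :=
  {x | z ∈ C ∧ ∀ ε : ℝ, 0 < ε → ∀ᶠ u in 𝓝[C] z, inner ℝ x (u - z) ≤ ε * ‖u - z‖}

/-! ## The problem class -/

/-- A closed convex polyhedron `{x | G x = g, F x ≤ f}` in `ℝ^d`. -/
structure PolyhedronData (d : ℕ) where
  numEq : ℕ
  numIneq : ℕ
  G : Matrix (Fin numEq) (Fin d) ℝ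
  g : Fin numEq → ℝ
  F : Matrix (Fin numIneq) (Fin d) ℝ
  f : Fin numIneq → ℝ

/-- The set described by the polyhedron data. -/
def PolyhedronData.toSet {d : ℕ} (D : PolyhedronData d) : Set (Fin d → ℝ) :=
  {x | D.G *ᵥ x = D.g ∧ ∀ l, (D.F *ᵥ x) l ≤ D.f l}

/-- The data of the problem `min ½ zᵀHz + hᵀz` subject to `z ∈ E ∩ Z`. The variable is
`z = (z_1, …, z_N)` with `z_k ∈ ℝ^(dim k)`, so that its coordinates are indexed by
`Σ k, Fin (dim k)`. -/
structure ProblemData where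
  /-- number of blocks -/
  N : ℕ
  /-- dimension of the `k`-th block -/
  dim : Fin N → ℕ
  /-- number of polyhedra in the `k`-th union -/
  numPieces : Fin N → ℕ
  /-- the polyhedra `Z_{k,i}` -/
  piece : (k : Fin N) → Fin (numPieces k) → PolyhedronData (dim k)
  /-- quadratic cost -/
  H : Matrix (Σ k : Fin N, Fin (dim k)) (Σ k : Fin N, Fin (dim k)) ℝ
  /-- linear cost -/
  h : EuclideanSpace ℝ (Σ k : Fin N, Fin (dim k))
  /-- number of coupling equations -/
  m : ℕ
  A : Matrix (Fin m) (Σ k : Fin N, Fin (dim k)) ℝ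
  b : Fin m → ℝ
  /-- number of columns of the parametrization `v ↦ V v + vbar` of `{z | A z = b}` -/
  q : ℕ
  V : Matrix (Σ k : Fin N, Fin (dim k)) (Fin q) ℝ
  vbar : EuclideanSpace ℝ (Σ k : Fin N, Fin (dim k))

namespace ProblemData

/-- The index set of the coordinates of `z`. -/
abbrev Idx (P : ProblemData) : Type := Σ k : Fin P.N, Fin (P.dim k)

/-- The ambient Euclidean space `ℝ^n`. -/
abbrev Space (P : ProblemData) : Type := EuclideanSpace ℝ P.Idx

variable (P : ProblemData)

/-- The affine set `E = {z | A z = b}`. -/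
def setE : Set P.Space := {z | P.A *ᵥ z.ofLp = P.b}

/-- The set `Z`, a product over the blocks of finite unions of polyhedra. -/
def setZ : Set P.Space :=
  {z | ∀ k : Fin P.N, ∃ i : Fin (P.numPieces k), (fun j => z ⟨k, j⟩) ∈ (P.piece k i).toSet}

/-- The standing assumptions: `H` is symmetric positive definite, `A` has full row rank, `V` has
full column rank, `E = {V v + vbar}`, and the problem is feasible. -/
structure Standing : Prop where
  posDef : P.H.PosDef
  fullRowRank : LinearIndependent ℝ P.A.row
  fullColRank : LinearIndependent ℝ P.V.col
  param : ∀ z : P.Space, z ∈ P.setE ↔ ∃ v : Fin P.q → ℝ, z.ofLp = P.V *ᵥ v + P.vbar.ofLp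
  feasible : (P.setE ∩ P.setZ).Nonempty

/-- The objective `½ zᵀHz + hᵀz`. -/
def cost (z : P.Space) : ℝ :=
  1 / 2 * inner ℝ z (P.H.toEuclideanLin z) + inner ℝ P.h z

/-- Local minima of the problem. -/
def IsLocalMinimum (z : P.Space) : Prop :=
  z ∈ P.setE ∩ P.setZ ∧ IsLocalMinOn P.cost (P.setE ∩ P.setZ) z

/-- Global minima of the problem. -/
def IsGlobalMinimum (z : P.Space) : Prop :=
  z ∈ P.setE ∩ P.setZ ∧ IsMinOn P.cost (P.setE ∩ P.setZ) z

/-! ## Regular and proximal KKT points -/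

/-- `0 ∈ {H z + h} + N_E(z) - {lam}`. -/
def Stationary (z lam : P.Space) : Prop :=
  ∃ v ∈ regNormalCone P.setE z, 0 = P.H.toEuclideanLin z + P.h + v - lam

/-- Regular KKT points `(z, lam)`: stationarity and `0 ∈ N_Z(z) + {lam}`. -/
def IsRegularKKT (z lam : P.Space) : Prop :=
  P.Stationary z lam ∧ ∃ v ∈ regNormalCone P.setZ z, 0 = v + lam

/-- `ξ`-proximal KKT points `(z, lam)`. -/
def IsProximalKKT (ξ : ℝ) (z lam : P.Space) : Prop :=
  P.Stationary z lam ∧ z ∈ euclProj P.setZ (z - (1 / ξ) • lam)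

/-! ## The operators -/

/-- `R = V (Vᵀ H V)⁻¹ Vᵀ`. -/
def R : Matrix P.Idx P.Idx ℝ := P.V * (P.Vᵀ * P.H * P.V)⁻¹ * P.Vᵀ

/-- `M_ξ = ξ (ξ R - I)⁻¹ R`. -/
def M (ξ : ℝ) : Matrix P.Idx P.Idx ℝ := ξ • ((ξ • P.R - 1)⁻¹ * P.R)

/-- `c_ξ = (ξ R - I)⁻¹ (R (h + H vbar) - vbar)`. -/
def c (ξ : ℝ) : P.Space :=
  (ξ • P.R - 1)⁻¹.toEuclideanLin
    (P.R.toEuclideanLin (P.h + P.H.toEuclideanLin P.vbar) - P.vbar)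

variable {P} in
theorem isHermitian_R (hP : P.Standing) : P.R.IsHermitian := by
  have hH : P.Hᵀ = P.H := by
    simpa [Matrix.IsHermitian, Matrix.conjTranspose_eq_transpose_of_trivial] using
      hP.posDef.isHermitian
  simp [Matrix.IsHermitian, Matrix.conjTranspose_eq_transpose_of_trivial, R,
    Matrix.transpose_mul, Matrix.transpose_nonsing_inv, hH, Matrix.mul_assoc]

variable {P} in
theorem isHermitian_M (hP : P.Standing) (ξ : ℝ) : (P.M ξ).IsHermitian := by
  have hR : P.Rᵀ = P.R := by
    simpa [Matrix.IsHermitian, Matrix.conjTranspose_eq_transpose_of_trivial] using isHermitian_R hP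
  have hcomm : P.R * (ξ • P.R - 1)⁻¹ = (ξ • P.R - 1)⁻¹ * P.R := by
    by_cases hu : IsUnit (ξ • P.R - 1).det
    · have h1 : P.R * (ξ • P.R - 1) = (ξ • P.R - 1) * P.R := by
        simp [Matrix.mul_sub, Matrix.sub_mul]
      calc P.R * (ξ • P.R - 1)⁻¹
          = (ξ • P.R - 1)⁻¹ * ((ξ • P.R - 1) * P.R) * (ξ • P.R - 1)⁻¹ := by
            rw [← Matrix.mul_assoc, Matrix.nonsing_inv_mul _ hu, Matrix.one_mul]
        _ = (ξ • P.R - 1)⁻¹ * P.R := by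
            rw [← h1, Matrix.mul_assoc, Matrix.mul_assoc, Matrix.mul_nonsing_inv _ hu,
              Matrix.mul_one]
    · simp [Matrix.nonsing_inv_apply_not_isUnit _ hu]
  simp [Matrix.IsHermitian, Matrix.conjTranspose_eq_transpose_of_trivial, M,
    Matrix.transpose_mul, Matrix.transpose_nonsing_inv, hR, hcomm]

variable {P} in
/-- `W = Q diag(½ Λ⁻¹, -I) Qᵀ`, where `M_ξ = Q diag(Λ, 0) Qᵀ` is the eigendecomposition of `M_ξ`,
with `Q` orthogonal and `Λ` the diagonal matrix of the nonzero eigenvalues (in any order). The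
matrix `W` does not depend on the choice of the eigendecomposition. -/
def W (hP : P.Standing) (ξ : ℝ) : Matrix P.Idx P.Idx ℝ :=
  ((isHermitian_M hP ξ).eigenvectorUnitary : Matrix P.Idx P.Idx ℝ) *
    Matrix.diagonal (fun i =>
      if (isHermitian_M hP ξ).eigenvalues i = 0 then (-1 : ℝ)
      else 1 / 2 * ((isHermitian_M hP ξ).eigenvalues i)⁻¹) *
    ((isHermitian_M hP ξ).eigenvectorUnitary : Matrix P.Idx P.Idx ℝ)ᵀ

/-- The set-valued operator `K_ξ(s) = {M_ξ s + c_ξ} - P_Z(s)`. -/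
def K (ξ : ℝ) (s : P.Space) : Set P.Space :=
  {x | ∃ y ∈ euclProj P.setZ s, x = (P.M ξ).toEuclideanLin s + P.c ξ - y}

variable {P} in
/-- The set-valued operator `T_ξ(s) = s - W K_ξ(s)`. -/
def T (hP : P.Standing) (ξ : ℝ) (s : P.Space) : Set P.Space :=
  {t | ∃ x ∈ P.K ξ s, t = s - (W hP ξ).toEuclideanLin x}

variable {P} in
/-- The set of fixed points of `T_ξ`. -/
def fixT (hP : P.Standing) (ξ : ℝ) : Set P.Space := {s | s ∈ T hP ξ s}

/-- The set of fixed points of `T_ξ` that correspond to `z`: all `s` for which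
`(z, ξ (z - s))` is a `ξ`-proximal KKT point. -/
def fixAt (ξ : ℝ) (z : P.Space) : Set P.Space := {s | P.IsProximalKKT ξ z (ξ • (z - s))}

/-! ## The assumptions -/

/-- A regular KKT point exists. -/
def AssumptionA1 : Prop := ∃ z lam : P.Space, P.IsRegularKKT z lam

/-- Nondegeneracy of the multipliers. -/
def AssumptionA2 : Prop :=
  ∀ z : P.Space, P.IsLocalMinimum z → ∀ ξ₁ : ℝ, 0 < ξ₁ →
    (P.fixAt ξ₁ z).Nonempty → z ∉ P.fixAt ξ₁ z →
      ∃ ξ : ℝ, ξ₁ ≤ ξ ∧ ∃ s ∈ P.fixAt ξ z,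
        -(ξ • (z - s)) ∈ intrinsicInterior ℝ (regNormalCone P.setZ z)

/-- Geometric regularity of `Z`. -/
def AssumptionA3 : Prop :=
  ∀ z ∈ P.setZ, regNormalCone P.setZ z = {0} ∨
    ∃ ε : ℝ, 0 < ε ∧ ∀ w : P.Space,
      (∀ v ∈ regNormalCone P.setZ z, inner ℝ v w = 0) → ‖w‖ ≤ ε → z + w ∈ P.setZ

/-! ## The algorithm -/

/-- The trivial candidate `vbar - R (h + H vbar)`, which is returned at once if it lies in `Z`. -/
def trivialPoint : P.Space :=
  P.vbar - P.R.toEuclideanLin (P.h + P.H.toEuclideanLin P.vbar)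

variable {P} in
/-- The sequences `s_0, s_1, …`, `z_1, z_2, …` and `y_1, y_2, …` are generated by the main loop of
the algorithm with step size `γ` (any selection of the projection is allowed; the terms `z 0` and
`y 0` are irrelevant). -/
structure IsRun (hP : P.Standing) (ξ γ : ℝ) (s z y : ℕ → P.Space) : Prop where
  step_z : ∀ j, z (j + 1) = (P.M ξ).toEuclideanLin (s j) + P.c ξ
  step_y : ∀ j, y (j + 1) ∈ euclProj P.setZ (s j)
  step_s : ∀ j, s (j + 1) = s j - γ • (W hP ξ).toEuclideanLin (z (j + 1) - y (j + 1))

variable {P} in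
/-- The main loop converges to a fixed point of `T_ξ` from all initial iterates sufficiently close
to `s₀`, for every step size in `(0, 1)`. -/
def ConvergesNear (hP : P.Standing) (ξ : ℝ) (s₀ : P.Space) : Prop :=
  ∃ ε : ℝ, 0 < ε ∧ ∀ γ : ℝ, 0 < γ → γ < 1 → ∀ s z y : ℕ → P.Space,
    IsRun hP ξ γ s z y → s 0 ∈ Metric.closedBall s₀ ε →
      ∃ sLim ∈ fixT hP ξ, Filter.Tendsto s Filter.atTop (𝓝 sLim)

end ProblemData

end

/-! Since `R` inverts `H` on the range of `V`, stationarity of `(z, lam)` means `z = trivialPoint +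
R lam` (`stationary_iff`), and `M s + c` is the only `z` for which `(z, ξ (z - s))` is stationary
(`M_add_c_eq_iff`). As `W` is injective, fixed points of `T` are therefore exactly the proximal KKT
pairs, written with `s` in place of the multiplier. A finite union of polyhedra is locally
star-shaped, so regular normals are nonpositive on nearby feasible directions. Hence KKT points are
local minima of the convex cost, and a regular multiplier is proximal for large `ξ`. Monotonicity of
`R` leaves at most one KKT point in each convex selection of pieces, so only finitely many points
`z` matter and a single threshold for `ξ` serves them all.

For local convergence, let `K` be the span of the normal cone at `z`. At a multiplier with strict
complementarity and strict quadratic growth, the projection onto `Z` coincides nearby with the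
projection onto `z + Kᗮ` (`exists_euclProj_eq`); (A3) makes that flat piece part of `Z`. The error
then evolves linearly, `e ↦ e - γ B e` with `B = W (M - Π)` and `Π` the projection onto `Kᗮ`. For `ξ
> ‖H‖` the eigenvalues of `M` are `0` or at least `1`, which makes `1 - B` nonexpansive for the
positive definite form `2 M + 1 - p`, with `p` the projection onto the range of `M`
(`IsSplitScaling.metric_step`); averaging by `γ` gives convergence.

(A2) supplies one nondegenerate multiplier. Any fixed point for the same `z` that is a convex
combination giving it positive weight inherits both properties; the remaining ones lie in the
relative boundary of a convex set, which is null. -/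

/-! ## Iterations that are averaged for a quadratic form -/

section Averaged

variable {E : Type*} [NormedAddCommGroup E] [InnerProductSpace ℝ E]

/-- Expansion of a symmetric quadratic form along a step `x - γ • b`. -/
theorem quadForm_sub_smul {S : E →ₗ[ℝ] E} (hS : S.IsSymmetric) (x b : E) (γ : ℝ) :
    inner ℝ (S (x - γ • b)) (x - γ • b)
      = inner ℝ (S x) x - 2 * γ * inner ℝ (S b) x + γ ^ 2 * inner ℝ (S b) b := by
  have h : inner ℝ (S x) b = inner ℝ (S b) x := by rw [hS x b, real_inner_comm]
  simp only [map_sub, map_smul, inner_sub_left, inner_sub_right, real_inner_smul_left,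
    real_inner_smul_right, h]
  ring

theorem quadForm_step_le {S B : E →ₗ[ℝ] E} (hS : S.IsSymmetric)
    (hB : ∀ x, inner ℝ (S (B x)) (B x) ≤ 2 * inner ℝ (S (B x)) x) {γ : ℝ} (h0 : 0 < γ) (x : E) :
    inner ℝ (S (x - γ • B x)) (x - γ • B x)
      ≤ inner ℝ (S x) x - γ * (1 - γ) * inner ℝ (S (B x)) (B x) := by
  rw [quadForm_sub_smul hS]
  nlinarith [hB x]

/-- The Krasnoselskii–Mann iteration `e ↦ e - γ B e` converges if `1 - B` is nonexpansive for a
positive definite quadratic form. -/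
theorem exists_tendsto_of_averaged [FiniteDimensional ℝ E] {S B : E →ₗ[ℝ] E} (hS : S.IsSymmetric)
    (hpos : ∀ x, ‖x‖ ^ 2 ≤ inner ℝ (S x) x)
    (hB : ∀ x, inner ℝ (S (B x)) (B x) ≤ 2 * inner ℝ (S (B x)) x)
    {γ : ℝ} (h0 : 0 < γ) (h1 : γ < 1) {e : ℕ → E} (he : ∀ j, e (j + 1) = e j - γ • B (e j)) :
    ∃ l, Filter.Tendsto e Filter.atTop (𝓝 l) := by
  have hQ : ∀ x, 0 ≤ inner ℝ (S x) x := fun x => (sq_nonneg _).trans (hpos x)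
  have hγ : 0 < γ * (1 - γ) := mul_pos h0 (by linarith)
  -- Fejér monotonicity towards every zero `f` of `B`. The case `f = 0` gives boundedness and `B (e
  -- j) → 0`.
  have hstep : ∀ f, B f = 0 → ∀ j, inner ℝ (S (e (j + 1) - f)) (e (j + 1) - f)
      ≤ inner ℝ (S (e j - f)) (e j - f) - γ * (1 - γ) * inner ℝ (S (B (e j))) (B (e j)) := by
    intro f hf j
    have h := quadForm_step_le hS hB h0 (e j - f)
    rw [map_sub B, hf, sub_zero] at h
    rw [he j, sub_right_comm]
    exact h
  have hanti : ∀ f, B f = 0 → Antitone fun j => inner ℝ (S (e j - f)) (e j - f) := by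
    intro f hf
    refine antitone_nat_of_succ_le fun j => (hstep f hf j).trans ?_
    nlinarith [mul_nonneg hγ.le (hQ (B (e j)))]
  have hanti0 := hanti 0 (map_zero B)
  have hlim := tendsto_atTop_ciInf hanti0
    ⟨0, by rintro _ ⟨j, rfl⟩; exact hQ _⟩
  have hdiff : Filter.Tendsto (fun j => (γ * (1 - γ))⁻¹ *
      (inner ℝ (S (e j - 0)) (e j - 0) - inner ℝ (S (e (j + 1) - 0)) (e (j + 1) - 0)))
      Filter.atTop (𝓝 0) := by
    have := (hlim.sub (hlim.comp (Filter.tendsto_add_atTop_nat 1))).const_mul (γ * (1 - γ))⁻¹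
    simpa using this
  have hBsq : Filter.Tendsto (fun j => ‖B (e j)‖ ^ 2) Filter.atTop (𝓝 0) := by
    refine squeeze_zero (fun j => sq_nonneg _) (fun j => ?_) hdiff
    rw [inv_mul_eq_div, le_div_iff₀ hγ]
    nlinarith [hstep 0 (map_zero B) j, hpos (B (e j))]
  have hBe : Filter.Tendsto (fun j => B (e j)) Filter.atTop (𝓝 0) := by
    rw [tendsto_zero_iff_norm_tendsto_zero]
    simpa using hBsq.sqrt
  have hbdd : Bornology.IsBounded (Set.range e) := by
    refine (Metric.isBounded_closedBall (x := (0 : E))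
      (r := √(inner ℝ (S (e 0 - 0)) (e 0 - 0)))).subset ?_
    rintro _ ⟨j, rfl⟩
    rw [mem_closedBall_zero_iff]
    refine Real.le_sqrt_of_sq_le ?_
    have := hanti0 (Nat.zero_le j)
    have h2 := hpos (e j)
    simp only [sub_zero] at this ⊢
    exact h2.trans this
  obtain ⟨f, -, φ, hφ, hf⟩ := tendsto_subseq_of_bounded hbdd (fun j => Set.mem_range_self j)
  have hBc : Continuous B := B.continuous_of_finiteDimensional
  have hSc : Continuous S := S.continuous_of_finiteDimensional
  have hBf : B f = 0 :=
    tendsto_nhds_unique ((hBc.tendsto f).comp hf) (hBe.comp hφ.tendsto_atTop)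
  have hcont : Continuous fun x => inner ℝ (S (x - f)) (x - f) := by fun_prop
  have hsub : Filter.Tendsto (fun j => inner ℝ (S (e (φ j) - f)) (e (φ j) - f))
      Filter.atTop (𝓝 0) := by
    have := (hcont.tendsto f).comp hf
    simpa [Function.comp_def] using this
  -- The cluster point `f` is a zero of `B`, so the form at `e j - f` is antitone; its limit along
  -- the subsequence is the limit of the whole sequence.
  have hall : Filter.Tendsto (fun j => inner ℝ (S (e j - f)) (e j - f)) Filter.atTop (𝓝 0) :=
    (tendsto_iff_tendsto_subseq_of_antitone (hanti f hBf) hφ.tendsto_atTop).2 hsub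
  refine ⟨f, ?_⟩
  rw [tendsto_iff_norm_sub_tendsto_zero]
  have hsq : Filter.Tendsto (fun j => ‖e j - f‖ ^ 2) Filter.atTop (𝓝 0) :=
    squeeze_zero (fun j => sq_nonneg _) (fun j => hpos _) hall
  simpa using hsq.sqrt

/-- `W` is half the pseudo-inverse of `M` on the range of `M`, and `-1` on its orthogonal
complement; `p` is the orthogonal projection onto the range of `M`, and `1 ≤ M` there. -/
structure IsSplitScaling (M W p : E →ₗ[ℝ] E) : Prop where
  symm_M : M.IsSymmetric
  symm_W : W.IsSymmetric
  symm_p : p.IsSymmetric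
  p_p : ∀ x, p (p x) = p x
  M_p : ∀ x, M (p x) = M x
  p_M : ∀ x, p (M x) = M x
  W_M : ∀ x, W (M x) = (1 / 2 : ℝ) • p x
  M_W : ∀ x, M (W x) = (1 / 2 : ℝ) • p x
  p_W : ∀ x, p (W x) = W (p x)
  W_eq : ∀ x, W x = W (p x) - (x - p x)
  le_M : ∀ x, ‖p x‖ ^ 2 ≤ inner ℝ (M x) x

/-- The metric for which the iteration is averaged. -/
def splitMetric (M p : E →ₗ[ℝ] E) : E →ₗ[ℝ] E := (2 : ℝ) • M + LinearMap.id - p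

theorem splitMetric_apply (M p : E →ₗ[ℝ] E) (x : E) :
    splitMetric M p x = (2 : ℝ) • M x + x - p x := rfl

namespace IsSplitScaling

variable {M W p : E →ₗ[ℝ] E}

theorem inner_p_p (h : IsSplitScaling M W p) (x y : E) : inner ℝ (p x) (p y) = inner ℝ (p x) y := by
  rw [← h.symm_p, h.p_p]

theorem W_injective (h : IsSplitScaling M W p) {x : E} (hx : W x = 0) : x = 0 := by
  have h1 : p x = 0 := by
    have := h.M_W x
    rw [hx, map_zero] at this
    simpa using this.symm
  have h2 := h.W_eq x
  rw [hx, h1, map_zero] at h2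
  simpa using h2.symm

theorem isSymmetric_metric (h : IsSplitScaling M W p) : (splitMetric M p).IsSymmetric := by
  refine LinearMap.IsSymmetric.sub (LinearMap.IsSymmetric.add ?_ LinearMap.IsSymmetric.id)
    h.symm_p
  intro x y
  simp [real_inner_smul_left, real_inner_smul_right, h.symm_M x y]

/-- From `M ≥ p` the metric satisfies `2 M + 1 - p ≥ 1 + p ≥ 1`. -/
theorem norm_sq_le_metric (h : IsSplitScaling M W p) (x : E) :
    ‖x‖ ^ 2 ≤ inner ℝ (splitMetric M p x) x := by
  have h1 := h.le_M x
  have h2 : inner ℝ (p x) x = ‖p x‖ ^ 2 := by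
    rw [← h.inner_p_p, real_inner_self_eq_norm_sq]
  simp only [splitMetric_apply,
    inner_sub_left, inner_add_left, real_inner_smul_left, h2, real_inner_self_eq_norm_sq]
  nlinarith [sq_nonneg ‖p x‖]

/-- The metric is chosen so that its product with `W` is the reflection `2 p - 1`, in which `W` no
longer appears. -/
theorem metric_W (h : IsSplitScaling M W p) (x : E) :
    splitMetric M p (W x) = p x - (x - p x) := by
  simp only [splitMetric_apply,
    h.M_W, h.p_W]
  rw [h.W_eq x, smul_smul]
  norm_num
  abel

/-- On the range of `M`, `2 W` is the inverse of `M ≥ 1`, hence at most `1`. With `b = 2 W p x`, the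
bound `le_M` reads `‖b‖² ≤ ⟪p x, b⟫`, and expanding `‖p x - b‖² ≥ 0` concludes. -/
theorem two_inner_W_p_le (h : IsSplitScaling M W p) (x : E) :
    2 * inner ℝ (p x) (W (p x)) ≤ ‖p x‖ ^ 2 := by
  have h1 := h.le_M (W (p x))
  rw [h.p_W, h.p_p, h.M_W, h.p_p, real_inner_smul_left] at h1
  have h2 := norm_sub_sq_real (p x) ((2 : ℝ) • W (p x))
  rw [real_inner_smul_right, norm_smul, mul_pow, Real.norm_eq_abs, sq_abs] at h2
  nlinarith [sq_nonneg ‖p x - (2 : ℝ) • W (p x)‖]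

/-- `1 - W (M - Π)` is nonexpansive for the metric `2 M + 1 - p`, when `Π` is an orthogonal
projection. -/
theorem metric_step (h : IsSplitScaling M W p) (x y : E) (hxy : inner ℝ y x = ‖y‖ ^ 2) :
    inner ℝ (splitMetric M p (W (M x - y))) (W (M x - y))
      ≤ 2 * inner ℝ (splitMetric M p (W (M x - y))) x := by
  have e1 : splitMetric M p (W (M x - y)) = M x - p y + (y - p y) := by
    rw [h.metric_W, map_sub, h.p_M]; abel
  have e2 : W (M x - y) = (1 / 2 : ℝ) • p x - W (p y) + (y - p y) := by
    rw [map_sub, h.W_M, h.W_eq y]; abel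
  rw [e1, e2]
  have i1 : inner ℝ (M x) (p x) = inner ℝ (M x) x := by rw [← h.symm_p, h.p_M]
  have i2 : inner ℝ (M x) (W (p y)) = (1 / 2) * inner ℝ (p y) x := by
    rw [← h.symm_W, h.W_M, real_inner_smul_left, h.inner_p_p, h.symm_p, real_inner_comm]
  have i3 : inner ℝ (M x) (y - p y) = 0 := by
    rw [← h.p_M, h.symm_p, map_sub, h.p_p, sub_self, inner_zero_right]
  have i4 : inner ℝ (p y) (p x) = inner ℝ (p y) x := h.inner_p_p y x
  have i5 : inner ℝ (p y) (y - p y) = 0 := by rw [inner_sub_right, h.inner_p_p, sub_self]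
  have i6 : inner ℝ (y - p y) (p x) = 0 := by
    rw [← h.symm_p, map_sub, h.p_p, sub_self, inner_zero_left]
  have i7 : inner ℝ (y - p y) (W (p y)) = 0 := by
    rw [← h.p_p y, ← h.p_W, ← h.symm_p, map_sub, h.p_p, h.p_p, sub_self, inner_zero_left]
  have i8 : inner ℝ (y - p y) x = ‖y‖ ^ 2 - inner ℝ (p y) x := by rw [inner_sub_left, hxy]
  have n1 : ‖y‖ ^ 2 = ‖p y‖ ^ 2 + ‖y - p y‖ ^ 2 := by
    have := norm_add_sq_real (p y) (y - p y)
    rw [i5] at this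
    simpa using this
  have n2 := norm_sub_sq_real (p x) (p y)
  rw [real_inner_comm, i4] at n2
  have hM := h.le_M x
  have hW := h.two_inner_W_p_le y
  simp only [inner_add_left, inner_sub_left (M x), inner_add_right, inner_sub_right _ _ (W (p y)),
    real_inner_smul_right, i1, i2, i3, i4, i5, i6, i7, i8, real_inner_self_eq_norm_sq (y - p y)]
  -- The gap between the two sides is at least `(3/2) ‖p x - p y‖² + ‖y - p y‖²`.
  nlinarith [sq_nonneg ‖p x - p y‖, sq_nonneg ‖y - p y‖, sq_nonneg ‖p y‖]

end IsSplitScaling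

end Averaged

/-! ## Convex sets up to null sets -/

/-- Almost every point of a convex set lies in a proper homothetic copy of the set with any given
centre `q` in the set. -/
theorem Convex.hausdorffMeasure_not_homothety {E : Type*} [NormedAddCommGroup E]
    [InnerProductSpace ℝ E] [FiniteDimensional ℝ E] [MeasurableSpace E] [BorelSpace E]
    {C : Set E} (hC : Convex ℝ C) {q : E} (hq : q ∈ C) :
    MeasureTheory.Measure.hausdorffMeasure (Module.finrank ℝ (vectorSpan ℝ C) : ℝ)
      {s | s ∈ C ∧ ¬ ∃ s' ∈ C, ∃ t : ℝ, 0 < t ∧ t ≤ 1 ∧ s = (1 - t) • s' + t • q} = 0 := by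
  set D := vectorSpan ℝ C
  -- Translation by `q` identifies `C` isometrically with a subset of its direction space, where the
  -- Hausdorff measure of full dimension is a Haar measure and the frontier of a convex set is null.
  have hiso : Isometry fun x : D => (x : E) + q :=
    (isometry_add_right q).comp D.subtypeₗᵢ.isometry
  set C' : Set D := (fun x : D => (x : E) + q) ⁻¹' C with hC'
  have hC'conv : Convex ℝ C' := by
    intro x hx y hy a b ha hb hab
    have := hC hx hy ha hb hab
    simp only [hC', Set.mem_preimage, Submodule.coe_add, Submodule.coe_smul] at this ⊢
    convert this using 1
    rw [smul_add, smul_add, add_add_add_comm, ← add_smul, hab, one_smul]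
  have hnull : MeasureTheory.Measure.hausdorffMeasure (Module.finrank ℝ D : ℝ)
      ((fun x : D => (x : E) + q) '' frontier C') = 0 := by
    rw [hiso.hausdorffMeasure_image (Or.inl (Nat.cast_nonneg _))]
    exact hC'conv.addHaar_frontier _
  refine MeasureTheory.measure_mono_null ?_ hnull
  rintro s ⟨hs, hnot⟩
  have hsD : s - q ∈ D := vsub_mem_vectorSpan ℝ hs hq
  refine ⟨⟨s - q, hsD⟩, ⟨subset_closure ?_, fun hint => hnot ?_⟩, by simp⟩
  · simpa [hC'] using hs
  · have hcont : Continuous fun t : ℝ => (1 + t) • (⟨s - q, hsD⟩ : D) := by fun_prop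
    have hev : ∀ᶠ t in 𝓝[>] (0 : ℝ), (1 + t) • (⟨s - q, hsD⟩ : D) ∈ C' := by
      refine Filter.Eventually.filter_mono nhdsWithin_le_nhds ?_
      have : (fun t : ℝ => (1 + t) • (⟨s - q, hsD⟩ : D)) 0 ∈ interior C' := by simpa using hint
      exact (hcont.continuousAt.eventually (isOpen_interior.mem_nhds this)).mono
        fun t ht => interior_subset ht
    obtain ⟨t, ht, ht0⟩ := (hev.and self_mem_nhdsWithin).exists
    have ht0 : 0 < t := ht0
    have h1 : (1 + t) ≠ 0 := by positivity
    refine ⟨(1 + t) • (s - q) + q, by simpa [hC'] using ht, t / (1 + t), by positivity, ?_, ?_⟩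
    · rw [div_le_one (by positivity)]; linarith
    · have : 1 - t / (1 + t) = (1 + t)⁻¹ := by field_simp; ring
      rw [this, smul_add, smul_smul, inv_mul_cancel₀ h1, one_smul, add_assoc, ← add_smul]
      have : (1 + t)⁻¹ + t / (1 + t) = 1 := by field_simp
      rw [this, one_smul, sub_add_cancel]

/-! ## Symmetric matrices as operators -/

theorem Matrix.toEuclideanLin_mul_apply {n : Type*} [Fintype n] [DecidableEq n]
    (A B : Matrix n n ℝ) (x : EuclideanSpace ℝ n) :
    (A * B).toEuclideanLin x = A.toEuclideanLin (B.toEuclideanLin x) := by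
  simp [Matrix.toLpLin_mul_same]

section Spectral

variable {n : Type*} [Fintype n] [DecidableEq n] {A : Matrix n n ℝ}

/-- The function `f` of the eigenvalues of a symmetric matrix. -/
noncomputable def Matrix.IsHermitian.diagFun (hA : A.IsHermitian) (f : n → ℝ) : Matrix n n ℝ :=
  (hA.eigenvectorUnitary : Matrix n n ℝ) * Matrix.diagonal f *
    (hA.eigenvectorUnitary : Matrix n n ℝ)ᵀ

namespace Matrix.IsHermitian

theorem diagFun_mul (hA : A.IsHermitian) (f g : n → ℝ) :
    hA.diagFun f * hA.diagFun g = hA.diagFun fun i => f i * g i := by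
  have hU : (hA.eigenvectorUnitary : Matrix n n ℝ)ᵀ *
      (hA.eigenvectorUnitary : Matrix n n ℝ) = 1 := by
    have := Unitary.coe_star_mul_self hA.eigenvectorUnitary
    rwa [Matrix.star_eq_conjTranspose, Matrix.conjTranspose_eq_transpose_of_trivial] at this
  simp only [diagFun, Matrix.mul_assoc]
  rw [← Matrix.mul_assoc _ᵀ, hU, Matrix.one_mul, ← Matrix.mul_assoc (Matrix.diagonal f),
    Matrix.diagonal_mul_diagonal]

theorem diagFun_one (hA : A.IsHermitian) : hA.diagFun (fun _ => 1) = 1 := by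
  have hU : (hA.eigenvectorUnitary : Matrix n n ℝ) *
      (hA.eigenvectorUnitary : Matrix n n ℝ)ᵀ = 1 := by
    have := Unitary.coe_mul_star_self hA.eigenvectorUnitary
    rwa [Unitary.coe_star, Matrix.star_eq_conjTranspose,
      Matrix.conjTranspose_eq_transpose_of_trivial] at this
  simp [diagFun, hU]

theorem diagFun_eigenvalues (hA : A.IsHermitian) : hA.diagFun hA.eigenvalues = A := by
  conv_rhs => rw [hA.spectral_theorem, Unitary.conjStarAlgAut_apply]
  simp only [diagFun, Matrix.star_eq_conjTranspose,
    Matrix.conjTranspose_eq_transpose_of_trivial]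
  rfl

theorem diagFun_smul (hA : A.IsHermitian) (r : ℝ) (f : n → ℝ) :
    r • hA.diagFun f = hA.diagFun fun i => r * f i := by
  have : Matrix.diagonal (fun i => r * f i) = r • Matrix.diagonal f := by
    rw [← Matrix.diagonal_smul]; rfl
  simp [diagFun, this]

theorem diagFun_sub (hA : A.IsHermitian) (f g : n → ℝ) :
    hA.diagFun f - hA.diagFun g = hA.diagFun fun i => f i - g i := by
  simp [diagFun, ← Matrix.diagonal_sub, Matrix.mul_sub, Matrix.sub_mul]

theorem isHermitian_diagFun (hA : A.IsHermitian) (f : n → ℝ) : (hA.diagFun f).IsHermitian := by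
  simp [Matrix.IsHermitian, diagFun, Matrix.conjTranspose_eq_transpose_of_trivial,
    Matrix.mul_assoc]

theorem posSemidef_diagFun (hA : A.IsHermitian) {f : n → ℝ} (hf : ∀ i, 0 ≤ f i) :
    (hA.diagFun f).PosSemidef := by
  have := (Matrix.PosSemidef.diagonal hf).mul_mul_conjTranspose_same
    (hA.eigenvectorUnitary : Matrix n n ℝ)
  rwa [Matrix.conjTranspose_eq_transpose_of_trivial] at this

theorem toEuclideanLin_eigenvectorBasis (hA : A.IsHermitian) (i : n) :
    A.toEuclideanLin (hA.eigenvectorBasis i) = hA.eigenvalues i • hA.eigenvectorBasis i := by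
  apply WithLp.ofLp_injective
  simpa using hA.mulVec_eigenvectorBasis i

/-- If `0 ≤ A ≤ A²` then the eigenvalues of `A` avoid `(-∞, 0)` and `(0, 1)`. -/
theorem eigenvalues_eq_zero_or_one_le (hA : A.IsHermitian)
    (h0 : ∀ x, 0 ≤ inner ℝ (A.toEuclideanLin x) x)
    (h1 : ∀ x, inner ℝ (A.toEuclideanLin x) x ≤ ‖A.toEuclideanLin x‖ ^ 2) (i : n) :
    hA.eigenvalues i = 0 ∨ 1 ≤ hA.eigenvalues i := by
  have e0 := h0 (hA.eigenvectorBasis i)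
  have e1 := h1 (hA.eigenvectorBasis i)
  have hn : ‖hA.eigenvectorBasis i‖ = 1 := hA.eigenvectorBasis.norm_eq_one i
  rw [hA.toEuclideanLin_eigenvectorBasis, real_inner_smul_left, real_inner_self_eq_norm_sq,
    hn] at e0 e1
  rw [norm_smul, hn, mul_one, Real.norm_eq_abs, sq_abs] at e1
  simp only [one_pow, mul_one] at e0 e1
  rcases e0.eq_or_lt with h | h
  · exact Or.inl h.symm
  · right; nlinarith

/-- The operators built from the eigendecomposition of a symmetric matrix `A` whose nonzero
eigenvalues are at least `1`. -/
theorem isSplitScaling (hA : A.IsHermitian)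
    (h : ∀ i, hA.eigenvalues i = 0 ∨ 1 ≤ hA.eigenvalues i) :
    IsSplitScaling A.toEuclideanLin
      (hA.diagFun fun i => if hA.eigenvalues i = 0 then (-1 : ℝ)
        else 1 / 2 * (hA.eigenvalues i)⁻¹).toEuclideanLin
      (hA.diagFun fun i => if hA.eigenvalues i = 0 then (0 : ℝ) else 1).toEuclideanLin := by
  have hD := hA.diagFun_eigenvalues
  have key : ∀ {f g k : n → ℝ}, (∀ i, f i * g i = k i) → ∀ x,
      (hA.diagFun f).toEuclideanLin ((hA.diagFun g).toEuclideanLin x)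
        = (hA.diagFun k).toEuclideanLin x := by
    intro f g k hk x
    rw [← Matrix.toEuclideanLin_mul_apply, hA.diagFun_mul, funext hk]
  set w := fun i => if hA.eigenvalues i = 0 then (-1 : ℝ) else 1 / 2 * (hA.eigenvalues i)⁻¹
  set u := fun i => if hA.eigenvalues i = 0 then (0 : ℝ) else 1
  have hsymm : ∀ f, (hA.diagFun f).toEuclideanLin.IsSymmetric := fun f =>
    Matrix.isSymmetric_toEuclideanLin_iff.2 (hA.isHermitian_diagFun f)
  have hhalf : ∀ x, (1 / 2 : ℝ) • (hA.diagFun u).toEuclideanLin x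
      = (hA.diagFun fun i => 1 / 2 * u i).toEuclideanLin x := by
    intro x
    rw [← hA.diagFun_smul, map_smul, LinearMap.smul_apply]
  have hA' : A.toEuclideanLin = (hA.diagFun hA.eigenvalues).toEuclideanLin := by rw [hD]
  rw [hA']
  refine ⟨hsymm _, hsymm _, hsymm _, key ?_, key ?_, key ?_, ?_, ?_, ?_, ?_, ?_⟩
  · intro i; by_cases hi : hA.eigenvalues i = 0 <;> simp [u, hi]
  · intro i; by_cases hi : hA.eigenvalues i = 0 <;> simp [u, hi]
  · intro i; by_cases hi : hA.eigenvalues i = 0 <;> simp [u, hi]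
  · intro x
    rw [hhalf]
    refine key (fun i => ?_) x
    by_cases hi : hA.eigenvalues i = 0 <;> simp [u, w, hi]
  · intro x
    rw [hhalf]
    refine key (fun i => ?_) x
    by_cases hi : hA.eigenvalues i = 0
    · simp [u, w, hi]
    · simp only [u, w, hi, if_false]; field_simp
  · intro x
    rw [← Matrix.toEuclideanLin_mul_apply, ← Matrix.toEuclideanLin_mul_apply, hA.diagFun_mul,
      hA.diagFun_mul]
    simp_rw [mul_comm]
  · intro x
    have h1 : x = (hA.diagFun fun _ => 1).toEuclideanLin x := by rw [hA.diagFun_one]; simp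
    conv_rhs => rw [← Matrix.toEuclideanLin_mul_apply, hA.diagFun_mul]
    conv_rhs => enter [2, 1]; rw [h1]
    simp only [← LinearMap.sub_apply, ← map_sub, hA.diagFun_sub]
    congr 3
    funext i
    by_cases hi : hA.eigenvalues i = 0 <;> simp [u, w, hi]
  · intro x
    have hps := Matrix.isPositive_toEuclideanLin_iff.2 (hA.posSemidef_diagFun
      (f := fun i => hA.eigenvalues i - u i) (fun i => by
        rcases h i with hi | hi
        · simp [u, hi]
        · have : hA.eigenvalues i ≠ 0 := by linarith
          simp [u, this, hi]))
    have h0 := hps.re_inner_nonneg_left x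
    rw [← hA.diagFun_sub, map_sub, LinearMap.sub_apply, inner_sub_left] at h0
    have h1 : inner ℝ ((hA.diagFun u).toEuclideanLin x) x
        = ‖(hA.diagFun u).toEuclideanLin x‖ ^ 2 := by
      rw [← real_inner_self_eq_norm_sq, hsymm u x ((hA.diagFun u).toEuclideanLin x),
        real_inner_comm, key (f := u) (g := u) (k := u)
          (fun i => by by_cases hi : hA.eigenvalues i = 0 <;> simp [u, hi])]
    rw [h1] at h0
    simpa using h0

end Matrix.IsHermitian

end Spectral

/-! ## The operators of the problem -/

namespace ProblemData

variable {P : ProblemData}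

theorem posDef_VtHV (hP : P.Standing) : (P.Vᵀ * P.H * P.V).PosDef := by
  have := hP.posDef.conjTranspose_mul_mul_same (B := P.V)
    (Matrix.mulVec_injective_iff.2 hP.fullColRank)
  rwa [Matrix.conjTranspose_eq_transpose_of_trivial] at this

theorem Vt_mul_H_mul_R (hP : P.Standing) : P.Vᵀ * P.H * P.R = P.Vᵀ := by
  have hu : IsUnit (P.Vᵀ * P.H * P.V).det :=
    (Matrix.isUnit_iff_isUnit_det _).1 (posDef_VtHV hP).isUnit
  rw [R, Matrix.mul_assoc P.V, ← Matrix.mul_assoc _ P.V, ← Matrix.mul_assoc,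
    Matrix.mul_nonsing_inv _ hu, Matrix.one_mul]

/-- It gives `⟪R x, x⟫ = ⟪R x, H (R x)⟫`, the source of every sign and size estimate on `R`. -/
theorem R_mul_H_mul_R (hP : P.Standing) : P.R * P.H * P.R = P.R := by
  have h := Vt_mul_H_mul_R hP
  conv_lhs => enter [1, 1]; rw [R]
  rw [Matrix.mul_assoc, Matrix.mul_assoc _ P.Vᵀ, ← Matrix.mul_assoc P.Vᵀ, h, R]

theorem isSymmetric_R (hP : P.Standing) : P.R.toEuclideanLin.IsSymmetric :=
  Matrix.isSymmetric_toEuclideanLin_iff.2 (isHermitian_R hP)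

theorem isSymmetric_H (hP : P.Standing) : P.H.toEuclideanLin.IsSymmetric :=
  Matrix.isSymmetric_toEuclideanLin_iff.2 hP.posDef.isHermitian

theorem inner_H_pos (hP : P.Standing) {x : P.Space} (hx : x ≠ 0) :
    0 < inner ℝ x (P.H.toEuclideanLin x) := by
  have h := hP.posDef.dotProduct_mulVec_pos (x := x.ofLp)
    (by simpa using hx)
  rw [EuclideanSpace.inner_eq_star_dotProduct]
  simpa [dotProduct_comm] using h

theorem inner_H_nonneg (hP : P.Standing) (x : P.Space) :
    0 ≤ inner ℝ x (P.H.toEuclideanLin x) := by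
  by_cases hx : x = 0
  · simp [hx]
  · exact (inner_H_pos hP hx).le

theorem inner_R_self (hP : P.Standing) (x : P.Space) :
    inner ℝ (P.R.toEuclideanLin x) x
      = inner ℝ (P.R.toEuclideanLin x) (P.H.toEuclideanLin (P.R.toEuclideanLin x)) := by
  conv_lhs => rw [← R_mul_H_mul_R hP]
  rw [Matrix.toEuclideanLin_mul_apply, Matrix.toEuclideanLin_mul_apply, isSymmetric_R hP,
    real_inner_comm]

theorem inner_R_nonneg (hP : P.Standing) (x : P.Space) :
    0 ≤ inner ℝ (P.R.toEuclideanLin x) x := by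
  rw [inner_R_self hP]; exact inner_H_nonneg hP _

theorem R_eq_zero_of_inner_nonpos (hP : P.Standing) {x : P.Space}
    (hx : inner ℝ (P.R.toEuclideanLin x) x ≤ 0) : P.R.toEuclideanLin x = 0 := by
  by_contra h
  rw [inner_R_self hP] at hx
  exact absurd (inner_H_pos hP h) (not_lt.2 hx)

variable (P) in
/-- The operator norm of the quadratic cost. -/
noncomputable def normH : ℝ := ‖P.H.toEuclideanLin.toContinuousLinearMap‖

theorem normH_nonneg : 0 ≤ P.normH := norm_nonneg _

/-- In spectral terms, the nonzero eigenvalues of `R` are at least `1 / ‖H‖`. So `ξ > ‖H‖` puts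
every nonzero eigenvalue of `ξ R` above `1`. -/
theorem inner_R_le (hP : P.Standing) (x : P.Space) :
    inner ℝ (P.R.toEuclideanLin x) x ≤ P.normH * ‖P.R.toEuclideanLin x‖ ^ 2 := by
  rw [inner_R_self hP]
  have h1 := P.H.toEuclideanLin.toContinuousLinearMap.le_opNorm (P.R.toEuclideanLin x)
  have h2 := real_inner_le_norm (P.R.toEuclideanLin x) (P.H.toEuclideanLin (P.R.toEuclideanLin x))
  have h3 : ‖P.H.toEuclideanLin (P.R.toEuclideanLin x)‖ ≤ P.normH * ‖P.R.toEuclideanLin x‖ := h1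
  nlinarith [norm_nonneg (P.R.toEuclideanLin x)]

theorem isUnit_sub_one (hP : P.Standing) {ξ : ℝ} (hξ : P.normH < ξ) :
    IsUnit (ξ • P.R - 1) := by
  have h0 : 0 < ξ := normH_nonneg.trans_lt hξ
  rw [← Matrix.mulVec_injective_iff_isUnit]
  have hlin : Function.Injective (Matrix.mulVecLin (ξ • P.R - 1)) := by
    rw [injective_iff_map_eq_zero]
    intro x hx
    have hx' : ξ • P.R.toEuclideanLin (WithLp.toLp 2 x) = WithLp.toLp 2 x := by
      apply WithLp.ofLp_injective
      simpa [Matrix.sub_mulVec, Matrix.smul_mulVec, sub_eq_zero] using hx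
    by_contra hne
    have hpos : 0 < ‖P.R.toEuclideanLin (WithLp.toLp 2 x)‖ := by
      rw [norm_pos_iff]
      intro h
      rw [h, smul_zero] at hx'
      exact hne (by simpa using hx'.symm)
    have h1 := inner_R_le hP (WithLp.toLp 2 x)
    conv_lhs at h1 => enter [3]; rw [← hx']
    rw [real_inner_smul_right, real_inner_self_eq_norm_sq] at h1
    nlinarith [pow_pos hpos 2]
  exact hlin

/-- `M_ξ s + c_ξ` is the solution `z` of `z = trivialPoint + ξ R (z - s)`. -/
theorem M_add_c_eq_iff (hP : P.Standing) {ξ : ℝ} (hξ : P.normH < ξ) (s z : P.Space) :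
    (P.M ξ).toEuclideanLin s + P.c ξ = z
      ↔ z = P.trivialPoint + P.R.toEuclideanLin (ξ • (z - s)) := by
  have hu : IsUnit (ξ • P.R - 1).det :=
    (Matrix.isUnit_iff_isUnit_det _).1 (isUnit_sub_one hP hξ)
  have h1 : (P.M ξ).toEuclideanLin s + P.c ξ = (ξ • P.R - 1)⁻¹.toEuclideanLin
      (ξ • P.R.toEuclideanLin s - P.trivialPoint) := by
    simp only [M, c, trivialPoint, map_smul, LinearMap.smul_apply,
      Matrix.toEuclideanLin_mul_apply, map_sub]
    abel
  have h2 : ∀ x : P.Space, (ξ • P.R - 1).toEuclideanLin x = ξ • P.R.toEuclideanLin x - x := by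
    intro x; simp [map_sub]
  have h3 : (P.M ξ).toEuclideanLin s + P.c ξ = z ↔
      ξ • P.R.toEuclideanLin s - P.trivialPoint = (ξ • P.R - 1).toEuclideanLin z := by
    rw [h1]
    constructor
    · rintro rfl
      rw [← Matrix.toEuclideanLin_mul_apply, Matrix.mul_nonsing_inv _ hu]; simp
    · intro h
      rw [h, ← Matrix.toEuclideanLin_mul_apply, Matrix.nonsing_inv_mul _ hu]; simp
  rw [h3, h2, map_smul, map_sub, smul_sub]
  constructor
  · intro h
    rw [sub_eq_sub_iff_add_eq_add] at h
    rw [← sub_eq_zero] at h ⊢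
    rw [← h]; abel
  · intro h
    rw [← sub_eq_zero] at h ⊢
    rw [← h]; abel

/-- The linear part of `M_add_c_eq_iff`, obtained by subtracting the instance `s = 0`. It describes
`M` without an inverse. -/
theorem M_apply (hP : P.Standing) {ξ : ℝ} (hξ : P.normH < ξ) (s : P.Space) :
    (P.M ξ).toEuclideanLin s
      = ξ • P.R.toEuclideanLin ((P.M ξ).toEuclideanLin s - s) := by
  have h := (M_add_c_eq_iff hP hξ s _).1 rfl
  have h0 := (M_add_c_eq_iff hP hξ 0 _).1 rfl
  simp only [map_zero, zero_add, sub_zero] at h0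
  have := congrArg₂ (· - ·) h h0
  simp only [add_sub_cancel_right] at this
  rw [add_sub_add_left_eq_sub, ← map_sub, ← smul_sub, map_smul] at this
  convert this using 3
  abel

/-- By `M_apply`, `⟪M x, M x - x⟫ = ξ ⟪R (M x - x), M x - x⟫`, and `R` is positive semidefinite. -/
theorem inner_M_le (hP : P.Standing) {ξ : ℝ} (hξ : P.normH < ξ) (x : P.Space) :
    inner ℝ ((P.M ξ).toEuclideanLin x) x ≤ ‖(P.M ξ).toEuclideanLin x‖ ^ 2 := by
  have h0 : 0 < ξ := normH_nonneg.trans_lt hξ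
  have h := inner_R_nonneg hP ((P.M ξ).toEuclideanLin x - x)
  have h1 : 0 ≤ inner ℝ ((P.M ξ).toEuclideanLin x) ((P.M ξ).toEuclideanLin x - x) := by
    conv_rhs => enter [2]; rw [M_apply hP hξ]
    rw [real_inner_smul_left]
    positivity
  rw [inner_sub_right, real_inner_self_eq_norm_sq] at h1
  linarith

/-- With `w = M x - x` one has `⟪M x, x⟫ = ‖M x‖² - ⟪M x, w⟫ = ξ² ‖R w‖² - ξ ⟪R w, w⟫`, which is at
least `ξ (ξ - ‖H‖) ‖R w‖²`. -/
theorem inner_M_nonneg (hP : P.Standing) {ξ : ℝ} (hξ : P.normH < ξ) (x : P.Space) :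
    0 ≤ inner ℝ ((P.M ξ).toEuclideanLin x) x := by
  have h0 : 0 < ξ := normH_nonneg.trans_lt hξ
  set u := (P.M ξ).toEuclideanLin x with hu
  have h := inner_R_le hP (u - x)
  have h1 : u = ξ • P.R.toEuclideanLin (u - x) := M_apply hP hξ x
  have h2 : inner ℝ u (u - x) = ξ * inner ℝ (P.R.toEuclideanLin (u - x)) (u - x) := by
    conv_lhs => enter [2]; rw [h1]
    rw [real_inner_smul_left]
  have h3 : ‖u‖ ^ 2 = ξ ^ 2 * ‖P.R.toEuclideanLin (u - x)‖ ^ 2 := by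
    conv_lhs => rw [h1]
    rw [norm_smul, mul_pow, Real.norm_eq_abs, sq_abs]
  rw [inner_sub_right, real_inner_self_eq_norm_sq, h3] at h2
  have h4 : ξ * inner ℝ (P.R.toEuclideanLin (u - x)) (u - x)
      ≤ ξ * (P.normH * ‖P.R.toEuclideanLin (u - x)‖ ^ 2) := by gcongr
  have h5 : ξ * (P.normH * ‖P.R.toEuclideanLin (u - x)‖ ^ 2)
      ≤ ξ * (ξ * ‖P.R.toEuclideanLin (u - x)‖ ^ 2) := by gcongr
  nlinarith

/-- The projection onto the range of `M_ξ`. -/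
theorem exists_isSplitScaling (hP : P.Standing) {ξ : ℝ} (hξ : P.normH < ξ) :
    ∃ p, IsSplitScaling (P.M ξ).toEuclideanLin (W hP ξ).toEuclideanLin p :=
  ⟨_, (isHermitian_M hP ξ).isSplitScaling
    ((isHermitian_M hP ξ).eigenvalues_eq_zero_or_one_le (inner_M_nonneg hP hξ)
      (inner_M_le hP hξ))⟩

end ProblemData

/-! ## Normal cones and the structure of the feasible set -/

section NormalCone

variable {ι : Type} [Fintype ι] {C : Set (EuclideanSpace ℝ ι)} {x z u : EuclideanSpace ℝ ι}

theorem inner_nonpos_of_segment_subset (hx : x ∈ regNormalCone C z) (hu : segment ℝ z u ⊆ C) :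
    inner ℝ x (u - z) ≤ 0 := by
  by_contra! hpos
  have hne : 0 < ‖u - z‖ := by
    rw [norm_pos_iff]
    intro h
    simp [h] at hpos
  -- The tolerance is half the slope along the segment, which points `z + t (u - z)` with small `t >
  -- 0` violate.
  have hev := hx.2 (inner ℝ x (u - z) / (2 * ‖u - z‖)) (by positivity)
  have hlim : Filter.Tendsto (fun t : ℝ => z + t • (u - z)) (𝓝[>] 0) (𝓝[C] z) := by
    refine tendsto_nhdsWithin_iff.2 ⟨?_, ?_⟩
    · have hc : Continuous fun t : ℝ => z + t • (u - z) := by fun_prop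
      have := (hc.tendsto 0).mono_left (nhdsWithin_le_nhds (s := Set.Ioi 0))
      simpa using this
    · filter_upwards [Ioo_mem_nhdsGT (show (0 : ℝ) < 1 by norm_num)] with t ht
      exact hu (segment_eq_image' ℝ z u ▸ ⟨t, ⟨ht.1.le, ht.2.le⟩, rfl⟩)
  obtain ⟨t, ht, ht0⟩ := ((hlim.eventually hev).and self_mem_nhdsWithin).exists
  have ht0 : 0 < t := ht0
  rw [add_sub_cancel_left, real_inner_smul_right, norm_smul, Real.norm_eq_abs, abs_of_pos ht0] at ht
  have : inner ℝ x (u - z) / (2 * ‖u - z‖) * (t * ‖u - z‖) = t * inner ℝ x (u - z) / 2 := by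
    field_simp
  rw [this] at ht
  nlinarith [mul_pos ht0 hpos]

theorem mem_regNormalCone_of_quadratic {ξ : ℝ} (hξ : 0 < ξ) (hz : z ∈ C)
    (h : ∀ u ∈ C, 2 * inner ℝ x (u - z) ≤ ξ * ‖u - z‖ ^ 2) : x ∈ regNormalCone C z := by
  refine ⟨hz, fun ε hε => ?_⟩
  have hball : ∀ᶠ u in 𝓝[C] z, u ∈ Metric.ball z (2 * ε / ξ) :=
    Filter.Eventually.filter_mono nhdsWithin_le_nhds
      (Metric.ball_mem_nhds z (by positivity))
  filter_upwards [hball, self_mem_nhdsWithin] with u hu huC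
  rw [mem_ball_iff_norm, lt_div_iff₀ hξ] at hu
  nlinarith [h u huC, norm_nonneg (u - z)]

theorem zero_mem_regNormalCone (hz : z ∈ C) : (0 : EuclideanSpace ℝ ι) ∈ regNormalCone C z :=
  ⟨hz, fun ε hε => Filter.Eventually.of_forall fun u => by
    rw [inner_zero_left]; positivity⟩

/-- A set containing `0` contains, around each point of its relative interior, a ball of its
linear span. -/
theorem exists_ball_subset_of_mem_intrinsicInterior {N : Set (EuclideanSpace ℝ ι)}
    (h0 : (0 : EuclideanSpace ℝ ι) ∈ N) (hx : x ∈ intrinsicInterior ℝ N) :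
    ∃ r : ℝ, 0 < r ∧ ∀ a ∈ Submodule.span ℝ N, ‖a‖ ≤ r → x + a ∈ N := by
  obtain ⟨y, hy, rfl⟩ := mem_intrinsicInterior.1 hx
  obtain ⟨r, hr, hball⟩ := Metric.isOpen_iff.1 isOpen_interior y hy
  have hspan : ∀ a ∈ Submodule.span ℝ N, (y : EuclideanSpace ℝ ι) + a ∈ affineSpan ℝ N := by
    intro a ha
    have hdir : a ∈ (affineSpan ℝ N).direction := by
      rw [direction_affineSpan, vectorSpan_eq_span_vsub_set_right ℝ h0]
      simpa using ha
    rw [add_comm]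
    exact AffineSubspace.vadd_mem_of_mem_direction hdir y.2
  refine ⟨r / 2, by positivity, fun a ha hna => ?_⟩
  have : (⟨y + a, hspan a ha⟩ : affineSpan ℝ N) ∈ Metric.ball y r := by
    rw [Metric.mem_ball, Subtype.dist_eq, dist_eq_norm, add_sub_cancel_left]
    linarith
  exact interior_subset (s := ((↑) ⁻¹' N : Set (affineSpan ℝ N))) (hball this)

/-- Expanding the squares turns projection into a growth inequality that is affine in `lam` and
monotone in `ξ`. Convexity of the fixed point sets and passage to larger `ξ` come from this form. -/
theorem mem_euclProj_sub_iff {ξ : ℝ} (hξ : 0 < ξ) {lam : EuclideanSpace ℝ ι} :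
    z ∈ euclProj C (z - (1 / ξ) • lam) ↔
      z ∈ C ∧ ∀ u ∈ C, 0 ≤ ξ * ‖u - z‖ ^ 2 + 2 * inner ℝ lam (u - z) := by
  refine and_congr_right fun _ => forall₂_congr fun u _ => ?_
  have e : ‖z - (1 / ξ) • lam - u‖ ^ 2 = ‖z - (1 / ξ) • lam - z‖ ^ 2
      + (1 / ξ) * (ξ * ‖u - z‖ ^ 2 + 2 * inner ℝ lam (u - z)) := by
    have h1 : z - (1 / ξ) • lam - u = -((u - z) + (1 / ξ) • lam) := by abel
    have h2 : z - (1 / ξ) • lam - z = -((1 / ξ) • lam) := by abel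
    rw [h1, h2, norm_neg, norm_neg, norm_add_sq_real, real_inner_smul_right, real_inner_comm]
    field_simp
    ring
  rw [← sq_le_sq₀ (norm_nonneg _) (norm_nonneg _), e, le_add_iff_nonneg_right,
    mul_nonneg_iff_of_pos_left (by positivity)]

end NormalCone

namespace ProblemData

variable {P : ProblemData}

variable (P) in
/-- The product of the polyhedra selected by `σ`. -/
def selection (σ : (k : Fin P.N) → Fin (P.numPieces k)) : Set P.Space :=
  {z | ∀ k, (fun j => z ⟨k, j⟩) ∈ (P.piece k (σ k)).toSet}

theorem mem_setZ_iff {z : P.Space} : z ∈ P.setZ ↔ ∃ σ, z ∈ P.selection σ :=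
  Classical.skolem

theorem convex_selection (σ : (k : Fin P.N) → Fin (P.numPieces k)) :
    Convex ℝ (P.selection σ) := by
  intro x hx y hy a b ha hb hab k
  have e : (fun j => (a • x + b • y) ⟨k, j⟩)
      = a • (fun j => x ⟨k, j⟩) + b • fun j => y ⟨k, j⟩ := by
    funext j; simp
  rw [e]
  refine ⟨?_, fun l => ?_⟩
  · rw [Matrix.mulVec_add, Matrix.mulVec_smul, Matrix.mulVec_smul, (hx k).1, (hy k).1,
      ← add_smul, hab, one_smul]
  · have h1 := (hx k).2 l
    have h2 := (hy k).2 l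
    rw [Matrix.mulVec_add, Matrix.mulVec_smul, Matrix.mulVec_smul]
    simp only [Pi.add_apply, Pi.smul_apply, smul_eq_mul]
    calc _ ≤ a * (P.piece k (σ k)).f l + b * (P.piece k (σ k)).f l := by gcongr
      _ = _ := by rw [← add_mul, hab, one_mul]

theorem isClosed_selection (σ : (k : Fin P.N) → Fin (P.numPieces k)) :
    IsClosed (P.selection σ) := by
  have : P.selection σ = ⋂ k, ({z : P.Space | (P.piece k (σ k)).G *ᵥ (fun j => z ⟨k, j⟩)
      = (P.piece k (σ k)).g} ∩ ⋂ l, {z : P.Space | ((P.piece k (σ k)).F *ᵥ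
        (fun j => z ⟨k, j⟩)) l ≤ (P.piece k (σ k)).f l}) := by
    ext z
    simp [selection, PolyhedronData.toSet]
  rw [this]
  have hc : ∀ k, Continuous fun z : P.Space => (fun j => z ⟨k, j⟩ : Fin (P.dim k) → ℝ) := by
    intro k; fun_prop
  refine isClosed_iInter fun k => IsClosed.inter ?_ (isClosed_iInter fun l => ?_)
  · exact isClosed_eq (Continuous.matrix_mulVec continuous_const (hc k)) continuous_const
  · exact isClosed_le
      ((continuous_apply l).comp (Continuous.matrix_mulVec continuous_const (hc k)))
      continuous_const

theorem isClosed_setZ : IsClosed P.setZ := by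
  have : P.setZ = ⋃ σ, P.selection σ := by
    ext z; simp [mem_setZ_iff]
  rw [this]
  exact isClosed_iUnion_of_finite isClosed_selection

theorem segment_subset_setZ {σ : (k : Fin P.N) → Fin (P.numPieces k)} {z u : P.Space}
    (hz : z ∈ P.selection σ) (hu : u ∈ P.selection σ) : segment ℝ z u ⊆ P.setZ :=
  fun _ hw => mem_setZ_iff.2 ⟨σ, (convex_selection σ).segment_subset hz hu hw⟩

/-- The set `Z` is star-shaped at each of its points, locally. -/
theorem eventually_segment_subset (z : P.Space) :
    ∀ᶠ u in 𝓝 z, u ∈ P.setZ → segment ℝ z u ⊆ P.setZ := by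
  -- The selections are closed and finite in number, so those that miss `z` also miss a
  -- neighbourhood of `z`.
  have h : ∀ᶠ u in 𝓝 z, ∀ σ, u ∈ P.selection σ → z ∈ P.selection σ := by
    rw [Filter.eventually_all]
    intro σ
    by_cases hz : z ∈ P.selection σ
    · exact Filter.Eventually.of_forall fun _ _ => hz
    · filter_upwards [(isClosed_selection σ).isOpen_compl.mem_nhds hz] with u hu h
      exact absurd h hu
  filter_upwards [h] with u hu huZ
  obtain ⟨σ, hσ⟩ := mem_setZ_iff.1 huZ
  exact segment_subset_setZ (hu σ hσ) hσ

/-! ## Stationarity and proximal multipliers -/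

theorem mem_setE_add (hP : P.Standing) {z : P.Space} (hz : z ∈ P.setE) (v : Fin P.q → ℝ) :
    z + WithLp.toLp 2 (P.V *ᵥ v) ∈ P.setE := by
  obtain ⟨w, hw⟩ := (hP.param z).1 hz
  refine (hP.param _).2 ⟨w + v, ?_⟩
  rw [WithLp.ofLp_add, hw, Matrix.mulVec_add]
  abel

/-- `E` contains a line through `z` in every direction `V v`; the choice `v = Vᵀ x` forces `Vᵀ x =
0`. -/
theorem Vt_mulVec_eq_zero_of_mem_regNormalCone (hP : P.Standing) {z x : P.Space}
    (hx : x ∈ regNormalCone P.setE z) : P.Vᵀ *ᵥ x.ofLp = 0 := by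
  have h : ∀ v : Fin P.q → ℝ, inner ℝ x (WithLp.toLp 2 (P.V *ᵥ v)) ≤ 0 := by
    intro v
    have hseg : segment ℝ z (z + WithLp.toLp 2 (P.V *ᵥ v)) ⊆ P.setE := by
      rw [segment_eq_image']
      rintro _ ⟨t, -, rfl⟩
      have := mem_setE_add hP hx.1 (t • v)
      rw [Matrix.mulVec_smul] at this
      simpa using this
    simpa using inner_nonpos_of_segment_subset hx hseg
  have key : ∀ v : Fin P.q → ℝ, (P.Vᵀ *ᵥ x.ofLp) ⬝ᵥ v ≤ 0 := by
    intro v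
    have := h v
    rw [EuclideanSpace.inner_eq_star_dotProduct] at this
    rw [Matrix.mulVec_transpose, ← Matrix.dotProduct_mulVec, dotProduct_comm]
    simpa using this
  have := key (P.Vᵀ *ᵥ x.ofLp)
  exact dotProduct_self_eq_zero.1 (le_antisymm this (by
    simpa using dotProduct_star_self_nonneg (P.Vᵀ *ᵥ x.ofLp)))

theorem mem_regNormalCone_setE (hP : P.Standing) {z x : P.Space} (hz : z ∈ P.setE)
    (hx : P.Vᵀ *ᵥ x.ofLp = 0) :
    x ∈ regNormalCone P.setE z ∧ ∀ u ∈ P.setE, inner ℝ x (u - z) = 0 := by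
  have h : ∀ u ∈ P.setE, inner ℝ x (u - z) = 0 := by
    intro u hu
    obtain ⟨w, hw⟩ := (hP.param z).1 hz
    obtain ⟨v, hv⟩ := (hP.param u).1 hu
    rw [EuclideanSpace.inner_eq_star_dotProduct]
    have : (u - z).ofLp = P.V *ᵥ (v - w) := by
      rw [WithLp.ofLp_sub, hw, hv, Matrix.mulVec_sub]; abel
    rw [this, star_trivial, dotProduct_comm, Matrix.dotProduct_mulVec, ← Matrix.mulVec_transpose,
      hx, zero_dotProduct]
  refine ⟨⟨hz, fun ε hε => ?_⟩, h⟩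
  filter_upwards [self_mem_nhdsWithin] with u hu
  rw [h u hu]; positivity

theorem R_apply_ofLp (x : P.Space) :
    (P.R.toEuclideanLin x).ofLp
      = P.V *ᵥ ((P.Vᵀ * P.H * P.V)⁻¹ *ᵥ (P.Vᵀ *ᵥ x.ofLp)) := by
  simp [R, Matrix.mulVec_mulVec, Matrix.mul_assoc]

theorem trivialPoint_add_R_mem (hP : P.Standing) (x : P.Space) :
    P.trivialPoint + P.R.toEuclideanLin x ∈ P.setE := by
  refine (hP.param _).2 ⟨(P.Vᵀ * P.H * P.V)⁻¹ *ᵥ (P.Vᵀ *ᵥ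
    (x - (P.h + P.H.toEuclideanLin P.vbar)).ofLp), ?_⟩
  rw [← R_apply_ofLp]
  have h : P.trivialPoint + P.R.toEuclideanLin x
      = P.R.toEuclideanLin (x - (P.h + P.H.toEuclideanLin P.vbar)) + P.vbar := by
    rw [trivialPoint, map_sub]; abel
  exact congrArg WithLp.ofLp h

/-- Normals to `E` are killed by `Vᵀ`, hence by `R`, and `R H` is the identity on the range of `V`;
applying `R` to the stationarity equation solves it for `z`. Conversely `Vᵀ H R = Vᵀ` shows that the
residual is normal to `E`. -/
theorem stationary_iff (hP : P.Standing) (z lam : P.Space) :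
    P.Stationary z lam ↔ z = P.trivialPoint + P.R.toEuclideanLin lam := by
  have hu : IsUnit (P.Vᵀ * P.H * P.V).det :=
    (Matrix.isUnit_iff_isUnit_det _).1 (posDef_VtHV hP).isUnit
  constructor
  · rintro ⟨v, hv, h0⟩
    obtain ⟨w, hw⟩ := (hP.param z).1 hv.1
    have hVv := Vt_mulVec_eq_zero_of_mem_regNormalCone hP hv
    have hv' : v = lam - P.h - P.H.toEuclideanLin z := by
      rw [eq_comm, ← sub_eq_zero]
      have h1 := congrArg Neg.neg h0
      rw [neg_zero] at h1
      rw [h1]; abel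
    have hz : z = P.vbar + WithLp.toLp 2 (P.V *ᵥ w) := by
      apply WithLp.ofLp_injective
      rw [hw]; simp [add_comm]
    have hR : P.R.toEuclideanLin v = 0 := by
      apply WithLp.ofLp_injective
      rw [R_apply_ofLp, hVv]; simp
    have hRHV : P.R.toEuclideanLin (P.H.toEuclideanLin (WithLp.toLp 2 (P.V *ᵥ w)))
        = WithLp.toLp 2 (P.V *ᵥ w) := by
      apply WithLp.ofLp_injective
      rw [R_apply_ofLp]
      simp only [Matrix.ofLp_toLpLin, Matrix.toLin'_apply, Matrix.mulVec_mulVec]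
      rw [← Matrix.mul_assoc P.Vᵀ, Matrix.nonsing_inv_mul _ hu, Matrix.mul_one]
    rw [hv', hz, map_add, map_sub, map_sub, map_add, hRHV, sub_eq_zero] at hR
    rw [hz, trivialPoint, map_add]
    rw [← sub_eq_zero] at hR ⊢
    rw [← neg_eq_zero, ← hR]
    abel
  · intro h
    have hzE : z ∈ P.setE := h ▸ trivialPoint_add_R_mem hP lam
    refine ⟨lam - P.h - P.H.toEuclideanLin z, (mem_regNormalCone_setE hP hzE ?_).1, by abel⟩
    have hVHR : ∀ y : P.Space, P.Vᵀ *ᵥ (P.H.toEuclideanLin (P.R.toEuclideanLin y)).ofLp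
        = P.Vᵀ *ᵥ y.ofLp := by
      intro y
      simp only [Matrix.ofLp_toLpLin, Matrix.toLin'_apply, Matrix.mulVec_mulVec]
      rw [← Matrix.mul_assoc, Vt_mul_H_mul_R hP]
    rw [h, trivialPoint]
    simp only [map_add, map_sub, WithLp.ofLp_sub, WithLp.ofLp_add, Matrix.mulVec_sub,
      Matrix.mulVec_add, hVHR]
    abel

variable (P) in
/-- `lam` is a `ξ`-proximal multiplier at `z`. -/
structure IsMultiplier (ξ : ℝ) (z lam : P.Space) : Prop where
  eq : z = P.trivialPoint + P.R.toEuclideanLin lam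
  mem : z ∈ P.setZ
  growth : ∀ u ∈ P.setZ, 0 ≤ ξ * ‖u - z‖ ^ 2 + 2 * inner ℝ lam (u - z)

theorem isProximalKKT_iff (hP : P.Standing) {ξ : ℝ} (hξ : 0 < ξ) {z lam : P.Space} :
    P.IsProximalKKT ξ z lam ↔ P.IsMultiplier ξ z lam := by
  rw [IsProximalKKT, stationary_iff hP, mem_euclProj_sub_iff hξ]
  exact ⟨fun h => ⟨h.1, h.2.1, h.2.2⟩, fun h => ⟨h.1, h.2, h.3⟩⟩

theorem mem_fixAt_iff (hP : P.Standing) {ξ : ℝ} (hξ : 0 < ξ) {z s : P.Space} :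
    s ∈ P.fixAt ξ z ↔ P.IsMultiplier ξ z (ξ • (z - s)) := isProximalKKT_iff hP hξ

theorem sub_smul_mem_fixAt (hP : P.Standing) {ξ : ℝ} (hξ : 0 < ξ) {z lam : P.Space}
    (h : P.IsMultiplier ξ z lam) : z - (1 / ξ) • lam ∈ P.fixAt ξ z := by
  rw [mem_fixAt_iff hP hξ, sub_sub_cancel, smul_smul, mul_one_div_cancel hξ.ne', one_smul]
  exact h

namespace IsMultiplier

variable {ξ ξ' : ℝ} {z lam : P.Space}

theorem mono (h : P.IsMultiplier ξ z lam) (hξ : ξ ≤ ξ') : P.IsMultiplier ξ' z lam :=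
  ⟨h.1, h.2, fun u hu => (h.3 u hu).trans (by gcongr)⟩

theorem neg_mem (h : P.IsMultiplier ξ z lam) (hξ : 0 < ξ) : -lam ∈ regNormalCone P.setZ z :=
  mem_regNormalCone_of_quadratic hξ h.mem fun u hu => by
    have := h.growth u hu
    rw [inner_neg_left]; linarith

end IsMultiplier

theorem cost_add (hP : P.Standing) (z d : P.Space) :
    P.cost (z + d) = P.cost z + inner ℝ (P.H.toEuclideanLin z + P.h) d
      + 1 / 2 * inner ℝ d (P.H.toEuclideanLin d) := by
  have h : inner ℝ d (P.H.toEuclideanLin z) = inner ℝ z (P.H.toEuclideanLin d) := by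
    rw [← isSymmetric_H hP, real_inner_comm]
  simp only [cost, map_add, inner_add_left, inner_add_right, h, isSymmetric_H hP z d]
  ring

/-- First order optimality at `z` in the direction of a feasible point `u`. -/
theorem cost_le_of_inner_nonneg (hP : P.Standing) {z u lam : P.Space}
    (h : z = P.trivialPoint + P.R.toEuclideanLin lam) (hu : u ∈ P.setE)
    (hlam : 0 ≤ inner ℝ lam (u - z)) : P.cost z ≤ P.cost u := by
  obtain ⟨v, hv, h0⟩ := (stationary_iff hP z lam).2 h
  have hvu := (mem_regNormalCone_setE hP hv.1 (Vt_mulVec_eq_zero_of_mem_regNormalCone hP hv)).2 u hu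
  have hgrad : P.H.toEuclideanLin z + P.h = lam - v := by
    rw [← sub_eq_zero, h0]; abel
  have h1 := cost_add hP z (u - z)
  rw [add_sub_cancel, hgrad, inner_sub_left, hvu] at h1
  have := inner_H_nonneg hP (u - z)
  linarith

/-- Near `z` the segment to a feasible `u` stays in `Z`, so the normal cone condition gives the
first order inequality at `u` itself, and convexity of the cost does the rest. -/
theorem isLocalMinimum_of_isRegularKKT (hP : P.Standing) {z lam : P.Space}
    (h : z = P.trivialPoint + P.R.toEuclideanLin lam)
    (hN : -lam ∈ regNormalCone P.setZ z) : P.IsLocalMinimum z := by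
  refine ⟨⟨h ▸ trivialPoint_add_R_mem hP lam, hN.1⟩, ?_⟩
  filter_upwards [nhdsWithin_le_nhds (eventually_segment_subset z), self_mem_nhdsWithin]
    with u h1 h2
  refine cost_le_of_inner_nonneg hP h h2.1 ?_
  have := inner_nonpos_of_segment_subset hN (h1 h2.2)
  rw [inner_neg_left] at this
  linarith

/-- A regular multiplier is a proximal multiplier for all large enough parameters. -/
theorem exists_isMultiplier {z lam : P.Space}
    (h : z = P.trivialPoint + P.R.toEuclideanLin lam)
    (hN : -lam ∈ regNormalCone P.setZ z) : ∃ ξ : ℝ, 0 < ξ ∧ P.IsMultiplier ξ z lam := by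
  obtain ⟨ρ, hρ, hball⟩ := Metric.eventually_nhds_iff_ball.1 (eventually_segment_subset z)
  -- Within distance `ρ` the linear term is already nonnegative. Beyond it, Cauchy–Schwarz and `‖u -
  -- z‖ ≥ ρ` let the quadratic term dominate; the `+ 1` only secures positivity.
  refine ⟨2 * ‖lam‖ / ρ + 1, by positivity, h, hN.1, fun u hu => ?_⟩
  rcases lt_or_ge ‖u - z‖ ρ with hlt | hge
  · have := inner_nonpos_of_segment_subset hN (hball u (mem_ball_iff_norm.2 hlt) hu)
    rw [inner_neg_left] at this
    have : 0 ≤ inner ℝ lam (u - z) := by linarith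
    positivity
  · have h1 := abs_le.1 (abs_real_inner_le_norm lam (u - z))
    have h2 : 2 * ‖lam‖ ≤ (2 * ‖lam‖ / ρ) * ‖u - z‖ := by
      rw [div_mul_eq_mul_div, le_div_iff₀ hρ]
      gcongr
    nlinarith [norm_nonneg (u - z), sq_nonneg ‖u - z‖]

/-- Each selection of polyhedra contains at most one KKT point. -/
theorem eq_of_mem_selection (hP : P.Standing) {σ : (k : Fin P.N) → Fin (P.numPieces k)}
    {z z' lam lam' : P.Space} (hz : z = P.trivialPoint + P.R.toEuclideanLin lam)
    (hz' : z' = P.trivialPoint + P.R.toEuclideanLin lam')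
    (hN : -lam ∈ regNormalCone P.setZ z) (hN' : -lam' ∈ regNormalCone P.setZ z')
    (hσ : z ∈ P.selection σ) (hσ' : z' ∈ P.selection σ) : z = z' := by
  have h1 := inner_nonpos_of_segment_subset hN (segment_subset_setZ hσ hσ')
  have h2 := inner_nonpos_of_segment_subset hN' (segment_subset_setZ hσ' hσ)
  have hd : z - z' = P.R.toEuclideanLin (lam - lam') := by
    rw [hz, hz', map_sub]; abel
  -- Adding the two normal cone inequalities gives `⟪z - z', lam - lam'⟫ ≤ 0`, against the
  -- monotonicity of `R`.
  have h3 : inner ℝ (P.R.toEuclideanLin (lam - lam')) (lam - lam') ≤ 0 := by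
    rw [← hd, real_inner_comm]
    rw [← neg_sub z z', inner_neg_left, inner_neg_right] at h1
    rw [inner_neg_left] at h2
    rw [inner_sub_left]
    linarith
  rw [← sub_eq_zero, hd]
  exact R_eq_zero_of_inner_nonpos hP h3

theorem finite_setOf_isMultiplier (hP : P.Standing) :
    {z : P.Space | ∃ ξ : ℝ, 0 < ξ ∧ ∃ lam, P.IsMultiplier ξ z lam}.Finite := by
  have hchoice : ∀ z : {z : P.Space | ∃ ξ : ℝ, 0 < ξ ∧ ∃ lam, P.IsMultiplier ξ z lam},
      ∃ σ, z.1 ∈ P.selection σ := by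
    rintro ⟨z, ξ, hξ, lam, h⟩
    exact mem_setZ_iff.1 h.mem
  choose σ hσ using hchoice
  refine Set.finite_coe_iff.1 (Finite.of_injective σ ?_)
  rintro ⟨z, ξ, hξ, lam, h⟩ ⟨z', ξ', hξ', lam', h'⟩ heq
  have h1 := hσ ⟨z, ξ, hξ, lam, h⟩
  have h2 := hσ ⟨z', ξ', hξ', lam', h'⟩
  rw [← heq] at h2
  exact Subtype.ext (eq_of_mem_selection hP h.eq h'.eq (h.neg_mem hξ) (h'.neg_mem hξ') h1 h2)
  
end ProblemData

/-! ## The projection near a nondegenerate fixed point -/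

section LocalProjection

variable {ι : Type} [Fintype ι] {C : Set (EuclideanSpace ℝ ι)} {z lam : EuclideanSpace ℝ ι}

theorem norm_sub_starProjection_sq (K : Submodule ℝ (EuclideanSpace ℝ ι))
    (x : EuclideanSpace ℝ ι) :
    inner ℝ (x - K.starProjection x) x = ‖x - K.starProjection x‖ ^ 2 := by
  have h := K.starProjection_inner_eq_zero x (K.starProjection x) (K.starProjection_apply_mem x)
  rw [← real_inner_self_eq_norm_sq, inner_sub_right, h, sub_zero]

/-- Under quadratic growth and strict complementarity, the projection onto `C` of the points near
`z - (1 / ξ) • lam` is the projection onto `z + Kᗮ`, where `K` is the span of the normal cone. -/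
theorem exists_euclProj_eq {ξ κ r ε : ℝ} (hξ : 0 < ξ) (hκ : 0 < κ) (hr : 0 < r) (hε : 0 < ε)
    (hz : z ∈ C) (K : Submodule ℝ (EuclideanSpace ℝ ι)) (hlam : lam ∈ K)
    (hgrowth : ∀ u ∈ C, κ * ‖u - z‖ ^ 2 ≤ ξ * ‖u - z‖ ^ 2 + 2 * inner ℝ lam (u - z))
    (hsharp : ∀ᶠ u in 𝓝 z, u ∈ C → r * ‖K.starProjection (u - z)‖ ≤ inner ℝ lam (u - z))
    (hflat : ∀ w ∈ Kᗮ, ‖w‖ ≤ ε → z + w ∈ C) :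
    ∃ η : ℝ, 0 < η ∧ ∀ e, ‖e‖ < η → ∀ y ∈ euclProj C (z - (1 / ξ) • lam + e),
      y = z + (e - K.starProjection e) := by
  obtain ⟨ρ, hρ, hball⟩ := Metric.eventually_nhds_iff_ball.1 hsharp
  -- The bound `κ * ρ / (2 * ξ)` forces `y` into the ball where `hsharp` holds, `ε` keeps the
  -- competitor `z + a` in `C`, and `r / ξ` lets the sharp linear term absorb the `K`-component of
  -- `e`.
  refine ⟨min (r / ξ) (min ε (κ * ρ / (2 * ξ))), by positivity, fun e he y hy => ?_⟩
  obtain ⟨he1, he2, he3⟩ : ‖e‖ < r / ξ ∧ ‖e‖ < ε ∧ ‖e‖ < κ * ρ / (2 * ξ) := by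
    simpa only [lt_min_iff] using he
  have hmin : ∀ u ∈ C,
      ‖y - z‖ ^ 2 - 2 * inner ℝ e (y - z) + (2 / ξ) * inner ℝ lam (y - z)
        ≤ ‖u - z‖ ^ 2 - 2 * inner ℝ e (u - z) + (2 / ξ) * inner ℝ lam (u - z) := by
    intro u hu
    have expand : ∀ v, ‖z - (1 / ξ) • lam + e - v‖ ^ 2 = ‖e - (1 / ξ) • lam‖ ^ 2
        + (‖v - z‖ ^ 2 - 2 * inner ℝ e (v - z) + (2 / ξ) * inner ℝ lam (v - z)) := by
      intro v
      have : z - (1 / ξ) • lam + e - v = (e - (1 / ξ) • lam) - (v - z) := by abel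
      rw [this, norm_sub_sq_real, inner_sub_left, real_inner_smul_left]
      ring
    have h := hy.2 u hu
    rw [← sq_le_sq₀ (norm_nonneg _) (norm_nonneg _), expand, expand] at h
    linarith
  have hnear : ‖y - z‖ < ρ := by
    have h1 := hmin z hz
    simp only [sub_self, norm_zero, inner_zero_right, mul_zero, ne_eq, OfNat.ofNat_ne_zero,
      not_false_eq_true, zero_pow, add_zero] at h1
    have h2 := hgrowth y hy.1
    have h3 := real_inner_le_norm e (y - z)
    have h4 : ξ * (‖y - z‖ ^ 2 - 2 * inner ℝ e (y - z) + 2 / ξ * inner ℝ lam (y - z)) ≤ 0 :=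
      mul_nonpos_of_nonneg_of_nonpos hξ.le h1
    have h5 : ξ * (2 / ξ * inner ℝ lam (y - z)) = 2 * inner ℝ lam (y - z) := by field_simp
    rw [mul_add, h5] at h4
    rw [lt_div_iff₀ (by positivity)] at he3
    by_contra! hge
    have hpos : 0 < ‖y - z‖ := hρ.trans_le hge
    have h6 : κ * ‖y - z‖ ^ 2 ≤ 2 * ξ * (‖e‖ * ‖y - z‖) := by nlinarith
    have h7 : κ * ‖y - z‖ ≤ 2 * ξ * ‖e‖ := by
      refine le_of_mul_le_mul_right ?_ hpos
      nlinarith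
    nlinarith
  have hsh := hball y (mem_ball_iff_norm.2 hnear) hy.1
  set a := e - K.starProjection e with ha
  have haK : a ∈ Kᗮ := K.sub_starProjection_mem_orthogonal e
  have hna : ‖a‖ ≤ ‖e‖ := by
    have h1 := norm_sub_starProjection_sq K e
    have h2 := real_inner_le_norm a e
    rw [h1] at h2
    by_contra! hlt
    nlinarith [norm_nonneg e]
  have hcomp := hmin (z + a) (hflat a haK (hna.trans he2.le))
  have hla : inner ℝ lam a = 0 := (Submodule.mem_orthogonal K a).1 haK lam hlam
  have hea : inner ℝ e a = ‖a‖ ^ 2 := by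
    rw [real_inner_comm]; exact norm_sub_starProjection_sq K e
  rw [add_sub_cancel_left, hla, hea] at hcomp
  have hew : inner ℝ e (y - z) = inner ℝ (y - z) a + inner ℝ e (K.starProjection (y - z)) := by
    rw [← K.inner_starProjection_left_eq_right, real_inner_comm a, ← inner_add_left, ha,
      sub_add_cancel]
  have hcs := real_inner_le_norm e (K.starProjection (y - z))
  have hdist := norm_sub_sq_real (y - z) a
  have hl : (2 / ξ) * (r * ‖K.starProjection (y - z)‖) ≤ (2 / ξ) * inner ℝ lam (y - z) := by
    gcongr
  have hl2 : ‖e‖ * ‖K.starProjection (y - z)‖ ≤ (r / ξ) * ‖K.starProjection (y - z)‖ := by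
    gcongr
  have hl3 : (2 / ξ) * (r * ‖K.starProjection (y - z)‖)
      = 2 * ((r / ξ) * ‖K.starProjection (y - z)‖) := by ring
  -- Comparison with `z + a` yields `‖y - z - a‖² ≤ 2 (‖e‖ - r / ξ) ‖K.starProjection (y - z)‖`.
  have hzero : ‖y - z - a‖ ^ 2 ≤ 0 := by
    rw [hew] at hcomp
    linarith
  have : y - z - a = 0 := by
    rw [← norm_eq_zero]
    exact pow_eq_zero_iff two_ne_zero |>.1 (le_antisymm hzero (sq_nonneg _))
  rw [← sub_eq_zero, ← this]
  abel

theorem isClosed_graph_euclProj (hC : IsClosed C) {s y : ℕ → EuclideanSpace ℝ ι}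
    {s' y' : EuclideanSpace ℝ ι} (hs : Filter.Tendsto s Filter.atTop (𝓝 s'))
    (hy : Filter.Tendsto y Filter.atTop (𝓝 y')) (h : ∀ j, y j ∈ euclProj C (s j)) :
    y' ∈ euclProj C s' :=
  ⟨hC.mem_of_tendsto hy (Filter.Eventually.of_forall fun j => (h j).1), fun u hu =>
    le_of_tendsto_of_tendsto' (hs.sub hy).norm (hs.sub_const u).norm fun j => (h j).2 u hu⟩

end LocalProjection

namespace ProblemData

variable {P : ProblemData}

/-! ## Fixed points -/

theorem mem_fixT_iff (hP : P.Standing) {ξ : ℝ} (hξ : P.normH < ξ) {s : P.Space} :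
    s ∈ fixT hP ξ ↔ (P.M ξ).toEuclideanLin s + P.c ξ ∈ euclProj P.setZ s := by
  obtain ⟨p, hp⟩ := exists_isSplitScaling hP hξ
  constructor
  · rintro ⟨x, ⟨y, hy, rfl⟩, h⟩
    have h1 : (W hP ξ).toEuclideanLin ((P.M ξ).toEuclideanLin s + P.c ξ - y) = 0 := by
      rw [eq_comm, sub_eq_self] at h
      exact h
    rw [sub_eq_zero.1 (hp.W_injective h1)]
    exact hy
  · intro h
    exact ⟨_, ⟨_, h, rfl⟩, by simp⟩

theorem mem_fixT_iff_exists (hP : P.Standing) {ξ : ℝ} (hξ : P.normH < ξ) {s : P.Space} :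
    s ∈ fixT hP ξ ↔ ∃ z, s ∈ P.fixAt ξ z := by
  have h0 : 0 < ξ := normH_nonneg.trans_lt hξ
  have hs : ∀ z : P.Space, z - (1 / ξ) • ξ • (z - s) = s := by
    intro z
    rw [smul_smul, one_div_mul_cancel h0.ne', one_smul, sub_sub_cancel]
  rw [mem_fixT_iff hP hξ]
  constructor
  · intro h
    refine ⟨_, (stationary_iff hP _ _).2 ((M_add_c_eq_iff hP hξ s _).1 rfl), ?_⟩
    rwa [hs]
  · rintro ⟨z, h1, h2⟩
    rw [hs] at h2
    rwa [(M_add_c_eq_iff hP hξ s z).2 ((stationary_iff hP _ _).1 h1)]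

theorem isLocalMinimum_of_mem_fixAt (hP : P.Standing) {ξ : ℝ} (hξ : 0 < ξ) {z s : P.Space}
    (h : s ∈ P.fixAt ξ z) : P.IsLocalMinimum z := by
  rw [mem_fixAt_iff hP hξ] at h
  exact isLocalMinimum_of_isRegularKKT hP h.eq (h.neg_mem hξ)

/-- For fixed `z`, the multiplier `ξ (z - s)` depends affinely on `s`, and all conditions on it are
affine equations or inequalities. -/
theorem convex_fixAt (hP : P.Standing) {ξ : ℝ} (hξ : 0 < ξ) (z : P.Space) :
    Convex ℝ (P.fixAt ξ z) := by
  intro s hs s' hs' a b ha hb hab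
  rw [mem_fixAt_iff hP hξ] at hs hs' ⊢
  have e : ξ • (z - (a • s + b • s')) = a • (ξ • (z - s)) + b • (ξ • (z - s')) := by
    rw [smul_comm a, smul_comm b, ← smul_add]
    congr 1
    rw [smul_sub, smul_sub, sub_add_sub_comm, ← add_smul, hab, one_smul]
  refine ⟨?_, hs.mem, fun u hu => ?_⟩
  · rw [e, map_add, map_smul _ a, map_smul _ b, ← sub_eq_iff_eq_add'.2 hs.eq,
      ← sub_eq_iff_eq_add'.2 hs'.eq, ← add_smul, hab, one_smul]
    abel
  · have h1 := mul_nonneg ha (hs.growth u hu)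
    have h2 := mul_nonneg hb (hs'.growth u hu)
    rw [e, inner_add_left, real_inner_smul_left _ _ a, real_inner_smul_left _ _ b]
    have : ξ * ‖u - z‖ ^ 2 = (a + b) * (ξ * ‖u - z‖ ^ 2) := by rw [hab, one_mul]
    rw [this]
    linarith

theorem trivialPoint_mem_fixT (hP : P.Standing) {ξ : ℝ} (hξ : P.normH < ξ)
    (h : P.trivialPoint ∈ P.setZ) : P.trivialPoint ∈ fixT hP ξ := by
  have h0 : 0 < ξ := normH_nonneg.trans_lt hξ
  refine (mem_fixT_iff_exists hP hξ).2 ⟨P.trivialPoint, (mem_fixAt_iff hP h0).2 ⟨?_, h, ?_⟩⟩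
  · simp
  · intro u _
    simp only [sub_self, smul_zero, inner_zero_left, mul_zero, add_zero]
    positivity

theorem isGlobalMinimum_trivialPoint (hP : P.Standing) (h : P.trivialPoint ∈ P.setZ) :
    P.IsGlobalMinimum P.trivialPoint := by
  refine ⟨⟨?_, h⟩, fun u hu => cost_le_of_inner_nonneg (lam := 0) hP (by simp) hu.1 (by simp)⟩
  simpa using trivialPoint_add_R_mem hP 0

/-! ## The iteration -/

/-- Successive differences of a convergent `s` vanish, so `W (z - y) → 0`; a left inverse of `W`
gives `z - y → 0`. The graph of the projection onto the closed set `Z` is closed, which identifies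
the limit as a fixed point. -/
theorem IsRun.limit (hP : P.Standing) {ξ γ : ℝ} (hξ : P.normH < ξ) (hγ : 0 < γ)
    {s z y : ℕ → P.Space} (hrun : IsRun hP ξ γ s z y) {sLim : P.Space}
    (hs : Filter.Tendsto s Filter.atTop (𝓝 sLim)) :
    sLim ∈ fixT hP ξ ∧ Filter.Tendsto (fun j => ‖z j - y j‖) Filter.atTop (𝓝 0) ∧
      ∃ zLim : P.Space, P.IsLocalMinimum zLim ∧ Filter.Tendsto z Filter.atTop (𝓝 zLim) ∧
        Filter.Tendsto y Filter.atTop (𝓝 zLim) := by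
  have h0 : 0 < ξ := normH_nonneg.trans_lt hξ
  obtain ⟨p, hp⟩ := exists_isSplitScaling hP hξ
  have hMc : Continuous (P.M ξ).toEuclideanLin := LinearMap.continuous_of_finiteDimensional _
  have hz1 : Filter.Tendsto (fun j => z (j + 1)) Filter.atTop
      (𝓝 ((P.M ξ).toEuclideanLin sLim + P.c ξ)) := by
    simp_rw [hrun.step_z]
    exact ((hMc.tendsto sLim).comp hs).add_const _
  have hW : Filter.Tendsto (fun j => (W hP ξ).toEuclideanLin (z (j + 1) - y (j + 1)))
      Filter.atTop (𝓝 0) := by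
    have h := (hs.sub (hs.comp (Filter.tendsto_add_atTop_nat 1))).const_smul γ⁻¹
    rw [sub_self, smul_zero] at h
    refine h.congr fun j => ?_
    simp only [Function.comp_apply]
    rw [hrun.step_s j, sub_sub_cancel, smul_smul, inv_mul_cancel₀ hγ.ne', one_smul]
  have hker : LinearMap.ker (W hP ξ).toEuclideanLin = ⊥ :=
    LinearMap.ker_eq_bot'.2 fun x hx => hp.W_injective hx
  obtain ⟨g, hg⟩ := LinearMap.exists_leftInverse_of_injective _ hker
  have hd1 : Filter.Tendsto (fun j => z (j + 1) - y (j + 1)) Filter.atTop (𝓝 0) := by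
    have hgc : Continuous g := LinearMap.continuous_of_finiteDimensional _
    have h := (hgc.tendsto 0).comp hW
    rw [map_zero] at h
    refine h.congr fun j => ?_
    exact LinearMap.congr_fun hg _
  have hy1 : Filter.Tendsto (fun j => y (j + 1)) Filter.atTop
      (𝓝 ((P.M ξ).toEuclideanLin sLim + P.c ξ)) := by
    have h := hz1.sub hd1
    simpa using h
  have hproj := isClosed_graph_euclProj isClosed_setZ hs hy1 hrun.step_y
  have hfix : sLim ∈ fixT hP ξ := (mem_fixT_iff hP hξ).2 hproj
  have hz := (Filter.tendsto_add_atTop_iff_nat 1).1 hz1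
  have hy := (Filter.tendsto_add_atTop_iff_nat 1).1 hy1
  refine ⟨hfix, ?_, _, ?_, hz, hy⟩
  · have := (hz.sub hy).norm
    simpa using this
  · obtain ⟨w, hw⟩ := (mem_fixT_iff_exists hP hξ).1 hfix
    have : (P.M ξ).toEuclideanLin sLim + P.c ξ = w :=
      (M_add_c_eq_iff hP hξ sLim w).2 ((stationary_iff hP _ _).1 hw.1)
    rw [this]
    exact isLocalMinimum_of_mem_fixAt hP h0 hw

/-- Local convergence near a fixed point around which the projection is affine. -/
theorem convergesNear_of_euclProj_eq (hP : P.Standing) {ξ η : ℝ} (hξ : P.normH < ξ)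
    {z s₀ : P.Space} (hs₀ : (P.M ξ).toEuclideanLin s₀ + P.c ξ = z) (K : Submodule ℝ P.Space)
    (hη : 0 < η) (hproj : ∀ e, ‖e‖ < η → ∀ y ∈ euclProj P.setZ (s₀ + e),
      y = z + (e - K.starProjection e)) :
    ConvergesNear hP ξ s₀ := by
  obtain ⟨p, hp⟩ := exists_isSplitScaling hP hξ
  set S := splitMetric (P.M ξ).toEuclideanLin p with hSdef
  set B : P.Space →ₗ[ℝ] P.Space := (W hP ξ).toEuclideanLin ∘ₗ
    ((P.M ξ).toEuclideanLin - (LinearMap.id - K.starProjection.toLinearMap)) with hBdef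
  have hBapp : ∀ x, B x = (W hP ξ).toEuclideanLin
      ((P.M ξ).toEuclideanLin x - (x - K.starProjection x)) := fun x => rfl
  have hSs : S.IsSymmetric := hp.isSymmetric_metric
  have hpos : ∀ x, ‖x‖ ^ 2 ≤ inner ℝ (S x) x := hp.norm_sq_le_metric
  have hB : ∀ x, inner ℝ (S (B x)) (B x) ≤ 2 * inner ℝ (S (B x)) x := fun x =>
    hp.metric_step x _ (norm_sub_starProjection_sq K x)
  have hSc : Continuous S := S.continuous_of_finiteDimensional
  have hQc : Continuous fun x => inner ℝ (S x) x := by fun_prop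
  have hev : ∀ᶠ x in 𝓝 (0 : P.Space), inner ℝ (S x) x < η ^ 2 := by
    refine hQc.continuousAt.eventually_lt continuousAt_const ?_
    rw [map_zero, inner_zero_left]
    positivity
  obtain ⟨δ, hδ, hball⟩ := Metric.eventually_nhds_iff_ball.1 hev
  refine ⟨δ / 2, by positivity, fun γ h0 h1 s z' y hrun hs => ?_⟩
  have hstep : ∀ j, ‖s j - s₀‖ < η → s (j + 1) - s₀ = (s j - s₀) - γ • B (s j - s₀) := by
    intro j hj
    have hy := hproj (s j - s₀) hj (y (j + 1)) (by
      rw [add_sub_cancel]; exact hrun.step_y j)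
    have hz : z' (j + 1) = z + (P.M ξ).toEuclideanLin (s j - s₀) := by
      rw [hrun.step_z, ← hs₀, map_sub]; abel
    rw [hrun.step_s, hy, hz, hBapp, add_sub_add_left_eq_sub]
    abel
  have hlt : ∀ x, inner ℝ (S x) x < η ^ 2 → ‖x‖ < η := fun x hx =>
    lt_of_pow_lt_pow_left₀ 2 hη.le ((hpos x).trans_lt hx)
  -- The sublevel set of the form at `η ^ 2` is invariant and lies in the ball of radius `η`, so the
  -- iterates never leave the region where the projection is affine.
  have hinv : ∀ j, inner ℝ (S (s j - s₀)) (s j - s₀) < η ^ 2 := by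
    intro j
    induction j with
    | zero =>
      refine hball _ ?_
      rw [mem_ball_zero_iff]
      rw [mem_closedBall_iff_norm] at hs
      linarith
    | succ j ih =>
      rw [hstep j (hlt _ ih)]
      refine (quadForm_step_le hSs hB h0 _).trans_lt (lt_of_le_of_lt ?_ ih)
      have h2 : 0 ≤ inner ℝ (S (B (s j - s₀))) (B (s j - s₀)) :=
        (sq_nonneg _).trans (hpos _)
      have h3 : 0 ≤ γ * (1 - γ) := mul_nonneg h0.le (by linarith)
      nlinarith [mul_nonneg h3 h2]
  obtain ⟨l, hl⟩ := exists_tendsto_of_averaged hSs hpos hB h0 h1 (e := fun j => s j - s₀)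
    fun j => hstep j (hlt _ (hinv j))
  have hlim : Filter.Tendsto s Filter.atTop (𝓝 (l + s₀)) := by
    simpa using hl.add_const s₀
  exact ⟨_, (hrun.limit hP hξ h0 hlim).1, hlim⟩

/-- Local convergence near the fixed points that are proper convex combinations of a fixed point
and a nondegenerate one. -/
theorem convergesNear_of_combination (hP : P.Standing) (hA3 : P.AssumptionA3) {ξ ξ₁ t : ℝ}
    (hξ : P.normH < ξ) (hξ₁ : ξ₁ < ξ) (ht0 : 0 < t) (ht1 : t ≤ 1) {z s lam : P.Space}
    (hz : z ≠ P.trivialPoint) (hs : s ∈ P.fixAt ξ z) (hlam : P.IsMultiplier ξ₁ z lam)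
    (hri : -lam ∈ intrinsicInterior ℝ (regNormalCone P.setZ z)) :
    ConvergesNear hP ξ ((1 - t) • s + t • (z - (1 / ξ) • lam)) := by
  have h0 : 0 < ξ := normH_nonneg.trans_lt hξ
  have hcomb : (1 - t) • s + t • (z - (1 / ξ) • lam) ∈ P.fixAt ξ z :=
    convex_fixAt hP h0 z hs (sub_smul_mem_fixAt hP h0 (hlam.mono hξ₁.le)) (by linarith) ht0.le
      (by ring)
  rw [mem_fixAt_iff hP h0] at hs hcomb
  set mu := ξ • (z - ((1 - t) • s + t • (z - (1 / ξ) • lam))) with hmu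
  have hmu' : mu = (1 - t) • (ξ • (z - s)) + t • lam := by
    rw [hmu]
    have : lam = ξ • (1 / ξ) • lam := by rw [smul_smul, mul_one_div_cancel h0.ne', one_smul]
    conv_rhs => rw [this]
    module
  have hs₀ : (1 - t) • s + t • (z - (1 / ξ) • lam) = z - (1 / ξ) • mu := by
    rw [hmu, smul_smul, one_div_mul_cancel h0.ne', one_smul, sub_sub_cancel]
  have hN := hcomb.neg_mem h0
  have hNs := hs.neg_mem h0
  set N := regNormalCone P.setZ z with hNdef
  set K := Submodule.span ℝ N with hK
  obtain ⟨r, hr, hball⟩ :=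
    exists_ball_subset_of_mem_intrinsicInterior (zero_mem_regNormalCone hlam.mem) hri
  -- If the normal cone were `{0}`, the multiplier `mu` would vanish and `z` would be
  -- `trivialPoint`.
  obtain ⟨ε, hε, hflat⟩ : ∃ ε : ℝ, 0 < ε ∧ ∀ w : P.Space,
      (∀ v ∈ N, inner ℝ v w = 0) → ‖w‖ ≤ ε → z + w ∈ P.setZ := by
    refine (hA3 z hlam.mem).resolve_left fun hzero => hz ?_
    rw [← hNdef] at hzero
    rw [hzero, Set.mem_singleton_iff, neg_eq_zero] at hN
    rw [hcomb.eq, hN, map_zero, add_zero]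
  have hmuK : mu ∈ K := by
    have := K.neg_mem (Submodule.subset_span hN)
    rwa [neg_neg] at this
  -- The weight `t` on `lam` transfers its slack: `lam` needs only `ξ₁ < ξ`, hence the growth
  -- surplus `t * (ξ - ξ₁)`, and the ball of radius `r` around `-lam` in the normal cone gives
  -- sharpness `t * r`.
  obtain ⟨η, hη, hproj⟩ := exists_euclProj_eq (κ := t * (ξ - ξ₁)) (r := t * r) h0
    (mul_pos ht0 (sub_pos.2 hξ₁)) (mul_pos ht0 hr) hε hlam.mem K hmuK
    (by
      intro u hu
      have h1 := mul_nonneg (sub_nonneg.2 ht1) (hs.growth u hu)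
      have h2 := mul_nonneg ht0.le (hlam.growth u hu)
      rw [hmu', inner_add_left, real_inner_smul_left _ _ (1 - t), real_inner_smul_left _ _ t]
      nlinarith)
    (by
      filter_upwards [eventually_segment_subset z] with u hu huZ
      have hpol : ∀ v ∈ N, inner ℝ v (u - z) ≤ 0 := fun v hv =>
        inner_nonpos_of_segment_subset hv (hu huZ)
      have h1 : 0 ≤ inner ℝ (ξ • (z - s)) (u - z) := by
        have := hpol _ hNs
        rw [inner_neg_left] at this
        linarith
      have h2 : r * ‖K.starProjection (u - z)‖ ≤ inner ℝ lam (u - z) := by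
        set k := K.starProjection (u - z) with hk
        have hkk : inner ℝ k (u - z) = ‖k‖ ^ 2 := by
          have h := K.starProjection_inner_eq_zero (u - z) k (K.starProjection_apply_mem _)
          rw [← hk, inner_sub_left, real_inner_self_eq_norm_sq, real_inner_comm] at h
          linarith
        have hnorm : ‖(r / ‖k‖) • k‖ ≤ r := by
          rw [norm_smul, norm_div, norm_norm, Real.norm_of_nonneg hr.le]
          rw [div_mul_eq_mul_div]
          exact div_le_of_le_mul₀ (norm_nonneg _) hr.le le_rfl
        -- The normal `-lam` is tilted by length `r` towards the component `k` of `u - z`. For `k =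
        -- 0` division by zero makes the tilt zero.
        have h := hpol _ (hball ((r / ‖k‖) • k)
          (K.smul_mem _ (K.starProjection_apply_mem _)) hnorm)
        rw [inner_add_left, inner_neg_left, real_inner_smul_left, hkk] at h
        have : r / ‖k‖ * ‖k‖ ^ 2 = r * ‖k‖ := by
          rcases eq_or_ne ‖k‖ 0 with h0 | h0
          · simp [h0]
          · field_simp
        linarith
      rw [hmu', inner_add_left, real_inner_smul_left _ _ (1 - t), real_inner_smul_left _ _ t]
      nlinarith [mul_nonneg (sub_nonneg.2 ht1) h1, mul_le_mul_of_nonneg_left h2 ht0.le])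
    (by
      intro w hw hnw
      exact hflat w (fun v hv => (Submodule.mem_orthogonal K w).1 hw v (Submodule.subset_span hv))
        hnw)
  rw [hs₀]
  refine convergesNear_of_euclProj_eq hP hξ ?_ K hη hproj
  rw [M_add_c_eq_iff hP hξ, sub_sub_cancel, smul_smul, mul_one_div_cancel h0.ne', one_smul]
  exact hcomb.eq

theorem exists_nondegenerate (hP : P.Standing) (hA2 : P.AssumptionA2) {z : P.Space}
    (hz : z ≠ P.trivialPoint) (h : ∃ ξ : ℝ, 0 < ξ ∧ ∃ lam, P.IsMultiplier ξ z lam) :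
    ∃ ξ : ℝ, ∃ lam, P.IsMultiplier ξ z lam ∧
      -lam ∈ intrinsicInterior ℝ (regNormalCone P.setZ z) := by
  obtain ⟨ξ, hξ, lam, hlam⟩ := h
  -- The hypothesis `z ∉ fixAt` of (A2) holds because the multiplier at `s = z` is zero, which would
  -- make `z` equal to `trivialPoint`.
  obtain ⟨ξ', hξ', s, hs, hri⟩ := hA2 z
    (isLocalMinimum_of_isRegularKKT hP hlam.eq (hlam.neg_mem hξ)) ξ hξ
    ⟨_, sub_smul_mem_fixAt hP hξ hlam⟩ (fun hmem => hz (by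
      have := ((mem_fixAt_iff hP hξ).1 hmem).eq
      simpa using this))
  exact ⟨ξ', _, (mem_fixAt_iff hP (hξ.trans_le hξ')).1 hs, hri⟩

end ProblemData

/-! ### Uniform threshold and conclusion -/

theorem mainTheorem3 (P : ProblemData) (hP : P.Standing)
    (hA1 : P.AssumptionA1) (hA2 : P.AssumptionA2) (hA3 : P.AssumptionA3) :
    ∃ ξ₀ : ℝ, 0 < ξ₀ ∧ ∀ ξ : ℝ, ξ₀ ≤ ξ →
      -- the operator is well defined and has fixed points
      IsUnit (ξ • P.R - 1) ∧ (ProblemData.fixT hP ξ).Nonempty ∧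
      -- the fixed points are exactly those that correspond to some local minimum
      (∀ s : P.Space, s ∈ ProblemData.fixT hP ξ ↔
        ∃ zl : P.Space, P.IsLocalMinimum zl ∧ s ∈ P.fixAt ξ zl) ∧
      -- if the algorithm stops at the initial check, it returns a fixed point and global minimum
      (P.trivialPoint ∈ P.setZ →
        P.trivialPoint ∈ ProblemData.fixT hP ξ ∧ P.IsGlobalMinimum P.trivialPoint) ∧
      -- local convergence for all fixed points corresponding to `zl`, up to a set of measure zero
      -- for the Lebesgue (Hausdorff) measure of the dimension of that convex set
      (∀ zl : P.Space, P.IsLocalMinimum zl → zl ≠ P.trivialPoint →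
        MeasureTheory.Measure.hausdorffMeasure
          (Module.finrank ℝ (vectorSpan ℝ (P.fixAt ξ zl)) : ℝ)
          {s | s ∈ P.fixAt ξ zl ∧ ¬ ProblemData.ConvergesNear hP ξ s} = 0) ∧
      -- whenever the iterates converge, they do so to a fixed point, and `z_j`, `y_j` converge to
      -- each other and to a local minimum
      (∀ γ : ℝ, 0 < γ → γ < 1 → ∀ s z y : ℕ → P.Space, ProblemData.IsRun hP ξ γ s z y →
        ∀ sLim : P.Space, Filter.Tendsto s Filter.atTop (𝓝 sLim) →
          sLim ∈ ProblemData.fixT hP ξ ∧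
          Filter.Tendsto (fun j => ‖z j - y j‖) Filter.atTop (𝓝 0) ∧
          ∃ zLim : P.Space, P.IsLocalMinimum zLim ∧
            Filter.Tendsto z Filter.atTop (𝓝 zLim) ∧
            Filter.Tendsto y Filter.atTop (𝓝 zLim)) := by
  obtain ⟨z₁, lam₁, hst₁, v₁, hv₁, hv0⟩ := hA1
  have hN₁ : -lam₁ ∈ regNormalCone P.setZ z₁ := by
    rwa [← eq_neg_of_add_eq_zero_left hv0.symm]
  obtain ⟨ξ₁, hξ₁, hmul₁⟩ :=
    ProblemData.exists_isMultiplier ((ProblemData.stationary_iff hP _ _).1 hst₁) hN₁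
  -- `b z` is a parameter at which `z` has a nondegenerate multiplier; `0` is a dummy value where
  -- none is required.
  have hnd : ∀ z : P.Space, ∃ b : ℝ, z ≠ P.trivialPoint →
      (∃ ξ : ℝ, 0 < ξ ∧ ∃ lam, P.IsMultiplier ξ z lam) →
        ∃ lam, P.IsMultiplier b z lam ∧ -lam ∈ intrinsicInterior ℝ (regNormalCone P.setZ z) := by
    intro z
    by_cases h : z ≠ P.trivialPoint ∧ ∃ ξ : ℝ, 0 < ξ ∧ ∃ lam, P.IsMultiplier ξ z lam
    · obtain ⟨b, hb⟩ := ProblemData.exists_nondegenerate hP hA2 h.1 h.2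
      exact ⟨b, fun _ _ => hb⟩
    · exact ⟨0, fun h1 h2 => absurd ⟨h1, h2⟩ h⟩
  choose b hb using hnd
  obtain ⟨β, hβ⟩ := ((ProblemData.finite_setOf_isMultiplier hP).image b).bddAbove
  -- The three bounds serve invertibility and the spectrum of `M`, nonemptiness through the KKT
  -- point of (A1), and the strict inequality `b zl < ξ` that provides the growth surplus.
  refine ⟨max (P.normH + 1) (max ξ₁ (β + 1)), lt_max_of_lt_right (lt_max_of_lt_left hξ₁),
    fun ξ hξ => ?_⟩
  obtain ⟨hξH, hξξ₁, hξβ⟩ : P.normH + 1 ≤ ξ ∧ ξ₁ ≤ ξ ∧ β + 1 ≤ ξ := by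
    simpa only [max_le_iff] using hξ
  have hH : P.normH < ξ := by linarith
  have h0 : 0 < ξ := ProblemData.normH_nonneg.trans_lt hH
  refine ⟨ProblemData.isUnit_sub_one hP hH, ?_, fun s => ?_, fun h => ?_, fun zl _ hne => ?_,
    fun γ hγ _ s z y hrun sLim hs => hrun.limit hP hH hγ hs⟩
  · exact ⟨_, (ProblemData.mem_fixT_iff_exists hP hH).2
      ⟨z₁, ProblemData.sub_smul_mem_fixAt hP h0 (hmul₁.mono hξξ₁)⟩⟩
  · rw [ProblemData.mem_fixT_iff_exists hP hH]
    exact exists_congr fun z =>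
      ⟨fun h => ⟨ProblemData.isLocalMinimum_of_mem_fixAt hP h0 h, h⟩, fun h => h.2⟩
  · exact ⟨ProblemData.trivialPoint_mem_fixT hP hH h,
      ProblemData.isGlobalMinimum_trivialPoint hP h⟩
  · rcases (P.fixAt ξ zl).eq_empty_or_nonempty with hempty | ⟨s, hs⟩
    · simp [hempty]
    · have hmem : ∃ ξ : ℝ, 0 < ξ ∧ ∃ lam, P.IsMultiplier ξ zl lam :=
        ⟨ξ, h0, _, (ProblemData.mem_fixAt_iff hP h0).1 hs⟩
      obtain ⟨lam, hlam, hri⟩ := hb zl hne hmem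
      have hbξ : b zl < ξ := by
        have := hβ ⟨zl, hmem, rfl⟩
        linarith
      -- The centre of the homotheties is the fixed point of the nondegenerate multiplier.
      refine MeasureTheory.measure_mono_null ?_
        ((ProblemData.convex_fixAt hP h0 zl).hausdorffMeasure_not_homothety
          (ProblemData.sub_smul_mem_fixAt hP h0 (hlam.mono hbξ.le)))
      rintro s' ⟨hs', hnot⟩
      refine ⟨hs', ?_⟩
      rintro ⟨s'', hs'', t, ht0, ht1, rfl⟩
      exact hnot (ProblemData.convergesNear_of_combination hP hA3 hH hbξ ht0 ht1 hne hs'' hlam hri)
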